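/- Let $M$ be a smooth 3-manifold without boundary (Hausdorff, second countable, not necessarily compact, connected or orientable a priori), and let $\xi$ be a contact structure on $M$: a plane field that near every point is the kernel of a smooth 1-form $\alpha$ with $\alpha\wedge d\alpha\neq 0$ everywhere. A Legendrian (respectively transverse) knot is a smoothly embedded circle $L\subset M$ with $T_xL\subset\xi_x$ (respectively $T_xL\oplus\xi_x=T_xM$) for all $x\in L$. Two Legendrian (transverse) knots $L_0,L_1$ are Legendrian (transversely) isotopic if there is a family $L_t$, $t\in[0,1]$, of Legendrian (transverse) knots from $L_0$ to $L_1$ that is smooth, i.e. $L_t=F(t,S^1)$ for a smooth map $F:[0,1]\times S^1\to M$ all of whose slices $F(t,\cdot)$ are Legendrian (transverse) embeddings. They are ambient contact isotopic if there is a smooth family $\phi_t$, $t\in[0,1]$, of contactomorphisms of $(M,\xi)$, i.e. diffeomorphisms with $d\phi_t(\xi_x)=\xi_{\phi_t(x)}$ for all $x$, such that $\phi_0=\mathrm{id}$ and $\phi_1(L_0)=L_1$. **Theorem.** Two Legendrian knots in $(M,\xi)$ are Legendrian isotopic if and only if they are ambient contact isotopic, and two transverse knots in $(M,\xi)$ are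 transversely isotopic if and only if they are ambient contact isotopic. Both statements hold also for oriented knots (embeddings $S^1\to M$ up to orientation-preserving reparametrization), with isotopies and $\phi_1$ required to respect the orientations. -/

import Mathlib

open Set Manifold
open scoped ContDiff

namespace ContactKnots

/-- The model space `ℝ³`. -/
abbrev E3 : Type := EuclideanSpace ℝ (Fin 3)

/-- The value `(α ∧ dα)_p(u, v, w)` for a differential 1-form `α` on (an open subset of) `ℝ³`. -/
noncomputable def wedgeExtDeriv (α : E3 → E3 [⋀^Fin 1]→L[ℝ] ℝ) (p u v w : E3) : ℝ :=
  α p ![u] * extDeriv α p ![v, w] - α p ![v] * extDeriv α p ![u, w]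
    + α p ![w] * extDeriv α p ![u, v]

section Manifold3

variable {M : Type*} [TopologicalSpace M] [ChartedSpace E3 M]

/-- `ξ` is a contact structure on the 3-manifold `M`: a field of linear subspaces of the tangent
spaces which near each point, read in a chart, is the kernel of a smooth 1-form `α` with
`α ∧ dα ≠ 0` everywhere. (In particular `α` vanishes nowhere, so each `ξ x` is a plane. The sign of
`α ∧ dα` does not depend on the choice of `α`, so `ξ` itself determines the orientation of `M` for
which it is positive.) -/
def IsContactStructure (ξ : ∀ x : M, Submodule ℝ (TangentSpace (𝓡 3) x)) : Prop :=
  ∀ x₀ : M, ∃ (V : Set E3) (α : E3 → E3 [⋀^Fin 1]→L[ℝ] ℝ),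
    IsOpen V ∧ chartAt E3 x₀ x₀ ∈ V ∧ ContDiffOn ℝ ∞ α V ∧
    (∀ p ∈ V, ∃ u v w : E3, wedgeExtDeriv α p u v w ≠ 0) ∧
    ∀ x ∈ (chartAt E3 x₀).source, chartAt E3 x₀ x ∈ V →
      ∀ v : TangentSpace (𝓡 3) x,
        v ∈ ξ x ↔ α (chartAt E3 x₀ x) ![mfderiv (𝓡 3) (𝓡 3) (chartAt E3 x₀) x v] = 0

/-- `γ` is a smoothly embedded circle whose tangent lines all lie in `ξ`. -/
def IsLegendrianEmbedding (ξ : ∀ x : M, Submodule ℝ (TangentSpace (𝓡 3) x)) (γ : Circle → M) :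
    Prop :=
  IsSmoothEmbedding (𝓡 1) (𝓡 3) ∞ γ ∧
    ∀ θ : Circle, (mfderiv (𝓡 1) (𝓡 3) γ θ).range ≤ ξ (γ θ)

/-- `γ` is a smoothly embedded circle whose tangent lines are all complementary to `ξ`. -/
def IsTransverseEmbedding (ξ : ∀ x : M, Submodule ℝ (TangentSpace (𝓡 3) x)) (γ : Circle → M) :
    Prop :=
  IsSmoothEmbedding (𝓡 1) (𝓡 3) ∞ γ ∧
    ∀ θ : Circle, IsCompl (mfderiv (𝓡 1) (𝓡 3) γ θ).range (ξ (γ θ))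

/-- A Legendrian knot: a subset of `M` that is an embedded circle everywhere tangent to `ξ`. -/
def IsLegendrianKnot (ξ : ∀ x : M, Submodule ℝ (TangentSpace (𝓡 3) x)) (L : Set M) : Prop :=
  ∃ γ : Circle → M, IsLegendrianEmbedding ξ γ ∧ range γ = L

/-- A transverse knot: a subset of `M` that is an embedded circle everywhere transverse to `ξ`. -/
def IsTransverseKnot (ξ : ∀ x : M, Submodule ℝ (TangentSpace (𝓡 3) x)) (T : Set M) : Prop :=
  ∃ γ : Circle → M, IsTransverseEmbedding ξ γ ∧ range γ = T

/-- `F t`, `t ∈ [0,1]`, is a smooth family of maps `S¹ → M`, all satisfying `P`. -/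
def IsIsotopyThrough (P : (Circle → M) → Prop) (F : ℝ → Circle → M) : Prop :=
  ContMDiffOn (𝓘(ℝ, ℝ).prod (𝓡 1)) (𝓡 3) ∞ (fun q : ℝ × Circle => F q.1 q.2)
      (Icc (0 : ℝ) 1 ×ˢ (univ : Set Circle)) ∧
    ∀ t ∈ Icc (0 : ℝ) 1, P (F t)

/-- `L₀` and `L₁` are joined by a smooth family of Legendrian knots. -/
def LegendrianIsotopic (ξ : ∀ x : M, Submodule ℝ (TangentSpace (𝓡 3) x)) (L₀ L₁ : Set M) : Prop :=
  ∃ F : ℝ → Circle → M, IsIsotopyThrough (IsLegendrianEmbedding ξ) F ∧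
    range (F 0) = L₀ ∧ range (F 1) = L₁

/-- `T₀` and `T₁` are joined by a smooth family of transverse knots. -/
def TransverseIsotopic (ξ : ∀ x : M, Submodule ℝ (TangentSpace (𝓡 3) x)) (T₀ T₁ : Set M) : Prop :=
  ∃ F : ℝ → Circle → M, IsIsotopyThrough (IsTransverseEmbedding ξ) F ∧
    range (F 0) = T₀ ∧ range (F 1) = T₁

/-- The diffeomorphism `φ` of `M` is a contactomorphism: `dφ(ξ_x) = ξ_{φ(x)}` for all `x`. -/
def IsContactomorphism (ξ : ∀ x : M, Submodule ℝ (TangentSpace (𝓡 3) x))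
    (φ : M ≃ₘ⟮𝓡 3, 𝓡 3⟯ M) : Prop :=
  ∀ x : M, (ξ x).map (mfderiv (𝓡 3) (𝓡 3) φ x).toLinearMap = ξ (φ x)

/-- `φ t`, `t ∈ [0,1]`, is a smooth one-parameter family of contactomorphisms of `(M, ξ)` starting
at the identity. Only the values for `t ∈ [0,1]` matter. -/
def IsContactIsotopy (ξ : ∀ x : M, Submodule ℝ (TangentSpace (𝓡 3) x))
    (φ : ℝ → (M ≃ₘ⟮𝓡 3, 𝓡 3⟯ M)) : Prop :=
  ContMDiffOn (𝓘(ℝ, ℝ).prod (𝓡 3)) (𝓡 3) ∞ (fun q : ℝ × M => φ q.1 q.2)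
      (Icc (0 : ℝ) 1 ×ˢ (univ : Set M)) ∧
    (∀ t ∈ Icc (0 : ℝ) 1, IsContactomorphism ξ (φ t)) ∧
    ∀ x : M, φ 0 x = x

/-- `L₀` and `L₁` are ambient contact isotopic. -/
def AmbientContactIsotopic (ξ : ∀ x : M, Submodule ℝ (TangentSpace (𝓡 3) x)) (L₀ L₁ : Set M) :
    Prop :=
  ∃ φ : ℝ → (M ≃ₘ⟮𝓡 3, 𝓡 3⟯ M), IsContactIsotopy ξ φ ∧ φ 1 '' L₀ = L₁

/-- Two embeddings `S¹ → M` parametrize the same oriented knot: they differ by an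
orientation-preserving diffeomorphism of the circle, given by its lift `σ : ℝ → ℝ`. -/
def SameOrientedKnot (γ γ' : Circle → M) : Prop :=
  ∃ σ : ℝ → ℝ, ContDiff ℝ ∞ σ ∧ (∀ s, 0 < deriv σ s) ∧
    ∀ s, γ (Circle.exp s) = γ' (Circle.exp (σ s))

/-- The oriented knots parametrized by `γ₀` and `γ₁` are Legendrian isotopic. -/
def OrientedLegendrianIsotopic (ξ : ∀ x : M, Submodule ℝ (TangentSpace (𝓡 3) x))
    (γ₀ γ₁ : Circle → M) : Prop :=
  ∃ F : ℝ → Circle → M, IsIsotopyThrough (IsLegendrianEmbedding ξ) F ∧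
    F 0 = γ₀ ∧ SameOrientedKnot (F 1) γ₁

/-- The oriented knots parametrized by `γ₀` and `γ₁` are transversely isotopic. -/
def OrientedTransverseIsotopic (ξ : ∀ x : M, Submodule ℝ (TangentSpace (𝓡 3) x))
    (γ₀ γ₁ : Circle → M) : Prop :=
  ∃ F : ℝ → Circle → M, IsIsotopyThrough (IsTransverseEmbedding ξ) F ∧
    F 0 = γ₀ ∧ SameOrientedKnot (F 1) γ₁

/-- The oriented knots parametrized by `γ₀` and `γ₁` are ambient contact isotopic. -/
def OrientedContactIsotopic (ξ : ∀ x : M, Submodule ℝ (TangentSpace (𝓡 3) x))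
    (γ₀ γ₁ : Circle → M) : Prop :=
  ∃ φ : ℝ → (M ≃ₘ⟮𝓡 3, 𝓡 3⟯ M), IsContactIsotopy ξ φ ∧ SameOrientedKnot (φ 1 ∘ γ₀) γ₁

end Manifold3

end ContactKnots

/-! One direction is immediate: if `φ t` is a contact isotopy and `γ` is Legendrian or transverse,
so is every `φ t ∘ γ`.

Conversely, the velocity of a family of knots has to be extended to a contact vector field. For a
contact form `A`, a function `H` determines a field `X` and a multiplier `g` by `A(X) = H` and
`dA(X, ·) + dH = g A` (`contactField`); then the Lie derivative of `A` along `X` is `g A`, so the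
flow preserves the kernel of `A`. The value of `X` at a point depends only on the 1-jet of `H`
there. It is therefore enough to find `H` with value `A(∂ₜγ)` and differential `c A - dA(∂ₜγ, ·)`
along the moving curve. The only compatibility condition, in the direction `∂ₛγ`, holds with `c = 0`
for Legendrian curves and can be solved for `c` when `A(∂ₛγ) ≠ 0` (`exists_multiplier`,
`exists_jet`).

Contact forms exist only locally, so the Hamiltonians are cut off in chart balls and the knot is
treated arc by arc. Once `Φ` follows the family `G` on a set `B` of parameters, `Φ⁻¹ G` is again a
contact family and is stationary on `B`. The next local isotopy leaves stationary points fixed, so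
the composite follows `G` on a larger set (`IsExtendableOn.union`). Compactness of the circle gives
short times, connectedness of the time line gives all times.

The flow of a time-dependent field, smooth in time and space together, comes from the contraction
principle and the implicit function theorem in a space of continuous curves. -/

namespace ContactKnots

/-! ### Smoothness of composition operators on continuous functions. -/

section Nemytskii

universe u

variable {S : Type} [TopologicalSpace S] [CompactSpace S] {E F : Type u}
  [NormedAddCommGroup E] [NormedSpace ℝ E] [NormedAddCommGroup F] [NormedSpace ℝ F]

/-- Pointwise evaluation of a family of continuous linear maps on a continuous function. -/
noncomputable def pointwiseApply (S : Type) [TopologicalSpace S] [CompactSpace S] (E F : Type u)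
    [NormedAddCommGroup E] [NormedSpace ℝ E] [NormedAddCommGroup F] [NormedSpace ℝ F] :
    C(S, E →L[ℝ] F) →L[ℝ] C(S, E) →L[ℝ] C(S, F) :=
  LinearMap.mkContinuous₂
    (LinearMap.mk₂ ℝ (fun (A : C(S, E →L[ℝ] F)) (η : C(S, E)) => (⟨fun s => A s (η s), by fun_prop⟩ : C(S, F)))
      (fun _ _ _ => by ext; simp) (fun _ _ _ => by ext; simp)
      (fun _ _ _ => by ext; simp) (fun _ _ _ => by ext; simp)) 1
    (fun A η => by
      rw [one_mul]
      refine (ContinuousMap.norm_le _ (by positivity)).2 fun s => ?_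
      exact ((A s).le_opNorm _).trans
        (mul_le_mul (A.norm_coe_le_norm s) (η.norm_coe_le_norm s) (norm_nonneg _) (norm_nonneg A)))

/-- The remainder must be small uniformly over `S`. Continuity of `η ↦ f' ∘ η` in the sup norm
provides one `δ` for all points, and the mean value inequality on the segments from `γ s` to `γ s +
η s` concludes. -/
theorem hasFDerivAt_postcomp {f : E → F} (hf : ContDiff ℝ 1 f) (γ : C(S, E)) :
    HasFDerivAt (fun η : C(S, E) => (⟨f, hf.continuous⟩ : C(E, F)).comp η)
      (pointwiseApply S E F
        ((⟨fderiv ℝ f, hf.continuous_fderiv (by simp)⟩ : C(E, E →L[ℝ] F)).comp γ)) γ := by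
  set D : C(E, E →L[ℝ] F) := ⟨fderiv ℝ f, hf.continuous_fderiv (by simp)⟩ with hD
  have hcont : Continuous fun η : C(S, E) => D.comp η := ContinuousMap.continuous_postcomp D
  rw [hasFDerivAt_iff_isLittleO_nhds_zero, Asymptotics.isLittleO_iff]
  intro c hc
  obtain ⟨δ, hδ, h⟩ := (Metric.continuousAt_iff (f := fun η : C(S, E) => D.comp η)).1
    (hcont.continuousAt (x := γ)) c hc
  filter_upwards [Metric.ball_mem_nhds (0 : C(S, E)) hδ] with η hη
  rw [mem_ball_zero_iff] at hη
  refine (ContinuousMap.norm_le _ (by positivity)).2 fun s => ?_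
  have key : ∀ z ∈ segment ℝ (γ s) (γ s + η s), ‖fderiv ℝ f z - fderiv ℝ f (γ s)‖ ≤ c := by
    intro z hz
    rw [segment_eq_image'] at hz
    obtain ⟨r, hr, rfl⟩ := hz
    have h1 : dist (γ + r • η) γ < δ := by
      rw [dist_eq_norm, add_sub_cancel_left, norm_smul, Real.norm_eq_abs, abs_of_nonneg hr.1]
      exact (mul_le_of_le_one_left (norm_nonneg _) hr.2).trans_lt hη
    have h2 := ((ContinuousMap.dist_lt_iff hc).1 (h h1) s).le
    simpa [hD, dist_eq_norm] using h2
  have := (convex_segment (γ s) (γ s + η s)).norm_image_sub_le_of_norm_hasFDerivWithin_le'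
    (f := f) (f' := fderiv ℝ f) (φ := fderiv ℝ f (γ s)) (C := c)
    (fun z _ => (hf.differentiable (by simp) z).hasFDerivAt.hasFDerivWithinAt) key
    (left_mem_segment _ _ _) (right_mem_segment _ _ _)
  simp only [add_sub_cancel_left] at this
  exact this.trans (mul_le_mul_of_nonneg_left (η.norm_coe_le_norm s) hc.le)

/-- Postcomposition with a `C^n` map is a `C^n` map between spaces of continuous functions. -/
theorem contDiff_postcomp_nat (n : ℕ) : ∀ {F : Type u} [NormedAddCommGroup F] [NormedSpace ℝ F]
    {f : E → F} (hf : ContDiff ℝ n f),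
    ContDiff ℝ n (fun η : C(S, E) => (⟨f, hf.continuous⟩ : C(E, F)).comp η) := by
  -- The target must vary in the induction, because the derivative of `f` takes values in `E →L[ℝ]
  -- F`; hence also the common universe of `E` and `F`.
  induction n with
  | zero =>
    intro F _ _ f hf
    exact contDiff_zero.2 (ContinuousMap.continuous_postcomp _)
  | succ n ih =>
    intro F _ _ f hf
    have h1 : ContDiff ℝ 1 f := hf.of_le (by simp)
    have hd : ContDiff ℝ n (fderiv ℝ f) := hf.fderiv_right (by simp)
    push_cast
    rw [contDiff_succ_iff_hasFDerivAt]
    refine ⟨_, ?_, fun γ => hasFDerivAt_postcomp h1 γ⟩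
    exact (pointwiseApply S E F).contDiff.comp (ih hd)

theorem contDiff_postcomp {f : E → F} (hf : ContDiff ℝ ∞ f) :
    ContDiff ℝ ∞ (fun η : C(S, E) => (⟨f, hf.continuous⟩ : C(E, F)).comp η) :=
  contDiff_infty.2 fun n => contDiff_postcomp_nat n (contDiff_infty.1 hf n)

end Nemytskii

/-! ### Smooth dependence of fixed points on parameters. -/

section FixedPoint

variable {P C : Type*} [NormedAddCommGroup P] [NormedSpace ℝ P] [CompleteSpace P]
  [NormedAddCommGroup C] [NormedSpace ℝ C] [CompleteSpace C]

/-- The fixed point of a smooth family of contractions depends smoothly on the parameter. -/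
theorem contDiffAt_fixedPoint {T : P × C → C} (hT : ContDiff ℝ ∞ T) {U : Set P} (hU : IsOpen U)
    {q : NNReal} (hq : q < 1) (hL : ∀ p ∈ U, LipschitzWith q fun c => T (p, c)) {g : P → C}
    (hg : ∀ p ∈ U, T (p, g p) = g p) {p : P} (hp : p ∈ U) : ContDiffAt ℝ ∞ g p := by
  set G : P × C → C := fun x => x.2 - T x with hG
  have hGc : ContDiff ℝ ∞ G := contDiff_snd.sub hT
  set A : C →L[ℝ] C := fderiv ℝ T (p, g p) ∘L .inr ℝ P C with hA
  have hTd : DifferentiableAt ℝ T (p, g p) := hT.differentiable (by simp) _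
  have hA1 : HasFDerivAt (fun c => T (p, c)) A (g p) := by
    have : HasFDerivAt (fun c : C => (p, c)) (.inr ℝ P C) (g p) := hasFDerivAt_prodMk_right p (g p)
    exact hTd.hasFDerivAt.comp (g p) this
  have hAn : ‖A‖ < 1 := by
    rw [← hA1.fderiv]
    exact (norm_fderiv_le_of_lipschitz ℝ (hL p hp)).trans_lt (by exact_mod_cast hq)
  -- The partial derivative `1 - A` is inverted by a Neumann series, the contraction constant being
  -- a bound for `‖A‖`.
  have hinv : (fderiv ℝ G (p, g p) ∘L .inr ℝ P C).IsInvertible := by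
    have h1 : fderiv ℝ G (p, g p) ∘L .inr ℝ P C = 1 - A := by
      have : HasFDerivAt G (.snd ℝ P C - fderiv ℝ T (p, g p)) (p, g p) :=
        hasFDerivAt_snd.sub hTd.hasFDerivAt
      rw [this.fderiv]
      ext c
      simp [hA]
    rw [h1]
    exact ⟨ContinuousLinearEquiv.unitsEquiv ℝ C (Units.oneSub A hAn), by ext; rfl⟩
  have hGp : ContDiffAt ℝ ∞ G (p, g p) := hGc.contDiffAt
  have h0 : G (p, g p) = 0 := by simp [hG, hg p hp]
  refine (hGp.contDiffAt_implicitFunction (by simp) hinv).congr_of_eventuallyEq ?_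
  filter_upwards [hGp.eventually_apply_implicitFunction (by simp) hinv, hU.mem_nhds hp]
    with p' h1 hp'
  rw [h0] at h1
  set c := hGp.implicitFunction (by simp) hinv p'
  have h2 : T (p', c) = c := (sub_eq_zero.1 h1).symm
  -- The implicit function also produces fixed points near `p`, and a contraction has only one.
  have hd : dist (g p') c ≤ q * dist (g p') c := by
    simpa [h2, hg p' hp'] using (hL p' hp').dist_le_mul (g p') c
  by_contra hne
  have := dist_pos.2 hne
  have hq' : (q : ℝ) < 1 := by exact_mod_cast hq
  nlinarith

end FixedPoint

/-! ### Smooth flows of Lipschitz vector fields. -/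

section Flow

universe u

variable {E : Type u} [NormedAddCommGroup E] [NormedSpace ℝ E] [CompleteSpace E]

/-- The interval on which rescaled integral curves are parametrized. -/
abbrev SymmInterval : Type := Icc (-1 : ℝ) 1

/-- The right endpoint of the interval. -/
def SymmInterval.one : SymmInterval := ⟨1, by norm_num, le_rfl⟩

@[simp]
theorem SymmInterval.coe_one : (SymmInterval.one : ℝ) = 1 := rfl

theorem neg_one_le_one_real : (-1 : ℝ) ≤ 1 := by norm_num

/-- The Volterra operator `η ↦ (s ↦ ∫₀ˢ η)`. -/
noncomputable def volterra (E : Type u) [NormedAddCommGroup E] [NormedSpace ℝ E]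
    [CompleteSpace E] : C(SymmInterval, E) →L[ℝ] C(SymmInterval, E) :=
  LinearMap.mkContinuous
    { toFun := fun η => ⟨fun s => ∫ u in (0 : ℝ)..s, IccExtend neg_one_le_one_real η u, by
        have h : Continuous (IccExtend neg_one_le_one_real η) := η.continuous.Icc_extend'
        exact (intervalIntegral.continuous_primitive
          (fun a b => h.intervalIntegrable a b) 0).comp continuous_subtype_val⟩
      map_add' := fun η ζ => by
        ext s
        have h : Continuous (IccExtend neg_one_le_one_real η) := η.continuous.Icc_extend'
        have h' : Continuous (IccExtend neg_one_le_one_real ζ) := ζ.continuous.Icc_extend'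
        simp only [ContinuousMap.coe_mk, ContinuousMap.add_apply]
        rw [← intervalIntegral.integral_add (h.intervalIntegrable _ _) (h'.intervalIntegrable _ _)]
        rfl
      map_smul' := fun c η => by
        ext s
        simp only [ContinuousMap.coe_mk, ContinuousMap.smul_apply, RingHom.id_apply]
        rw [← intervalIntegral.integral_smul]
        rfl } 1
    (fun η => by
      rw [one_mul]
      refine (ContinuousMap.norm_le _ (norm_nonneg η)).2 fun s => ?_
      refine (intervalIntegral.norm_integral_le_of_norm_le_const
        (C := ‖η‖) fun u _ => η.norm_coe_le_norm _).trans ?_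
      rw [sub_zero]
      exact mul_le_of_le_one_right (norm_nonneg η) (abs_le.2 s.2))

theorem volterra_apply (η : C(SymmInterval, E)) (s : SymmInterval) :
    volterra E η s = ∫ u in (0 : ℝ)..s, IccExtend neg_one_le_one_real η u := rfl

theorem norm_volterra_le (η : C(SymmInterval, E)) : ‖volterra E η‖ ≤ ‖η‖ := by
  refine (ContinuousMap.norm_le _ (norm_nonneg η)).2 fun s => ?_
  rw [volterra_apply]
  refine (intervalIntegral.norm_integral_le_of_norm_le_const
    (C := ‖η‖) fun u _ => η.norm_coe_le_norm _).trans ?_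
  rw [sub_zero]
  exact mul_le_of_le_one_right (norm_nonneg η) (abs_le.2 s.2)

/-- The constant function, as a continuous linear map of its value. -/
noncomputable def constCLM (E : Type u) [NormedAddCommGroup E] [NormedSpace ℝ E] :
    E →L[ℝ] C(SymmInterval, E) :=
  LinearMap.mkContinuous
    { toFun := fun x => ContinuousMap.const _ x
      map_add' := fun _ _ => rfl
      map_smul' := fun _ _ => rfl } 1
    (fun x => by
      rw [one_mul]
      exact (ContinuousMap.norm_le _ (norm_nonneg x)).2 fun s => le_rfl)

/-- The Picard operator of the rescaled equation `γ' = t • V(γ)`, `γ(0) = x`. -/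
noncomputable def scaledPicard (V : C(E, E)) (p : (ℝ × E) × C(SymmInterval, E)) :
    C(SymmInterval, E) :=
  constCLM E p.1.2 + p.1.1 • volterra E (V.comp p.2)

theorem scaledPicard_apply (V : C(E, E)) (p : (ℝ × E) × C(SymmInterval, E)) (s : SymmInterval) :
    scaledPicard V p s =
      p.1.2 + p.1.1 • ∫ u in (0 : ℝ)..s, IccExtend neg_one_le_one_real (V ∘ p.2) u := rfl

theorem lipschitzWith_scaledPicard {V : C(E, E)} {K : NNReal} (hK : LipschitzWith K V)
    {t : ℝ} (ht : |t| * (2 * (K + 1)) ≤ 1) (x : E) :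
    LipschitzWith (1 / 2) fun γ => scaledPicard V ((t, x), γ) := by
  refine LipschitzWith.of_dist_le_mul fun γ η => ?_
  rw [dist_eq_norm]
  have : scaledPicard V ((t, x), γ) - scaledPicard V ((t, x), η) =
      t • volterra E (V.comp γ - V.comp η) := by
    simp [scaledPicard, map_sub, smul_sub]
  rw [this, norm_smul, Real.norm_eq_abs]
  have h1 : ‖V.comp γ - V.comp η‖ ≤ K * dist γ η := by
    refine (ContinuousMap.norm_le _ (by positivity)).2 fun s => ?_
    have := hK.dist_le_mul (γ s) (η s)
    rw [dist_eq_norm] at this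
    exact this.trans (mul_le_mul_of_nonneg_left (ContinuousMap.dist_apply_le_dist s) K.2)
  have h2 := (norm_volterra_le (V.comp γ - V.comp η)).trans h1
  have h3 : |t| * K ≤ 1 / 2 := by nlinarith [abs_nonneg t]
  calc |t| * ‖volterra E (V.comp γ - V.comp η)‖ ≤ |t| * (K * dist γ η) := by gcongr
    _ = (|t| * K) * dist γ η := by ring
    _ ≤ ((1 / 2 : NNReal) : ℝ) * dist γ η := by
      push_cast
      gcongr

theorem contDiff_scaledPicard {V : E → E} (hV : ContDiff ℝ ∞ V) :
    ContDiff ℝ ∞ (scaledPicard ⟨V, hV.continuous⟩) := by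
  have h1 : ContDiff ℝ ∞ fun p : (ℝ × E) × C(SymmInterval, E) =>
      volterra E ((⟨V, hV.continuous⟩ : C(E, E)).comp p.2) :=
    (volterra E).contDiff.comp ((contDiff_postcomp hV).comp contDiff_snd)
  have h2 : ContDiff ℝ ∞ fun p : (ℝ × E) × C(SymmInterval, E) => constCLM E p.1.2 :=
    (constCLM E).contDiff.comp (contDiff_snd.comp contDiff_fst)
  exact h2.add ((contDiff_fst.comp contDiff_fst).smul h1)

/-- A smooth, globally Lipschitz vector field has a smooth flow, defined for a uniform time. -/
theorem exists_smooth_flow {V : E → E} (hV : ContDiff ℝ ∞ V) {K : NNReal}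
    (hK : LipschitzWith K V) :
    ∃ ε > (0 : ℝ), ∃ φ : ℝ → E → E,
      (∀ t ∈ Ioo (-ε) ε, ∀ x, ContDiffAt ℝ ∞ (fun p : ℝ × E => φ p.1 p.2) (t, x)) ∧
      (∀ x, φ 0 x = x) ∧
      ∀ t ∈ Ioo (-ε) ε, ∀ x, HasDerivAt (fun s => φ s x) (V (φ t x)) t := by
  set VC : C(E, E) := ⟨V, hV.continuous⟩ with hVC
  have hKpos : (0 : ℝ) < 2 * (K + 1) := by positivity
  -- This bound on `|t|` makes the Picard operator a contraction with constant `1 / 2`; the summand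
  -- 1 covers `K = 0`.
  set ε : ℝ := 1 / (2 * (K + 1)) with hε
  have hεpos : 0 < ε := by positivity
  set U : Set (ℝ × E) := {p | |p.1| < ε} with hU
  have hUo : IsOpen U := isOpen_lt (continuous_abs.comp continuous_fst) continuous_const
  have hL : ∀ p ∈ U, LipschitzWith (1 / 2) fun γ => scaledPicard VC (p, γ) := by
    rintro ⟨t, x⟩ ht
    refine lipschitzWith_scaledPicard hK ?_ x
    have : |t| < ε := ht
    rw [hε, lt_div_iff₀ hKpos] at this
    exact this.le
  have hhalf : (1 / 2 : NNReal) < 1 := by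
    rw [← NNReal.coe_lt_coe]; norm_num
  have hfix : ∀ p : ℝ × E, ∃ γ, p ∈ U → scaledPicard VC (p, γ) = γ := by
    intro p
    by_cases hp : p ∈ U
    · have hc : ContractingWith (1 / 2) fun γ => scaledPicard VC (p, γ) := ⟨hhalf, hL p hp⟩
      exact ⟨hc.fixedPoint _, fun _ => hc.fixedPoint_isFixedPt⟩
    · exact ⟨0, fun h => absurd h hp⟩
  choose g hg using hfix
  have huniq : ∀ p ∈ U, ∀ γ, scaledPicard VC (p, γ) = γ → γ = g p := fun p hp γ hγ =>
    ContractingWith.fixedPoint_unique' ⟨hhalf, hL p hp⟩ hγ (hg p hp)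
  -- Time has become a parameter of the rescaled equation, which yields joint smoothness in `(t,
  -- x)`. The curves for different parameters are rescalings of one solution: `u ↦ g (t, x) (s u)`
  -- is a fixed point for the parameter `t s`.
  have hscale : ∀ t x, |t| < ε → ∀ s : SymmInterval,
      g (t * s, x) .one = g (t, x) s := by
    intro t x ht s
    have hsm : ∀ u : SymmInterval, (s : ℝ) * u ∈ Icc (-1 : ℝ) 1 := fun u => by
      rw [mem_Icc, ← abs_le, abs_mul]
      exact mul_le_one₀ (abs_le.2 s.2) (abs_nonneg _) (abs_le.2 u.2)
    set c : C(SymmInterval, E) := (g (t, x)).comp ⟨fun u => ⟨s * u, hsm u⟩, by fun_prop⟩ with hc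
    have hts : |t * s| < ε := by
      rw [abs_mul]
      exact (mul_le_of_le_one_right (abs_nonneg _) (abs_le.2 s.2)).trans_lt ht
    have : c = g (t * s, x) := by
      refine huniq _ hts c ?_
      ext u
      rw [scaledPicard_apply]
      have h1 : c u = scaledPicard VC ((t, x), g (t, x)) ⟨s * u, hsm u⟩ := by
        rw [hg (t, x) ht]; rfl
      rw [h1, scaledPicard_apply]
      simp only
      rw [mul_smul]
      congr 2
      have h2 := intervalIntegral.smul_integral_comp_mul_left (a := 0) (b := (u : ℝ))
        (IccExtend neg_one_le_one_real (VC ∘ g (t, x))) (s : ℝ)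
      rw [mul_zero] at h2
      rw [← h2]
      congr 1
      refine intervalIntegral.integral_congr fun v hv => ?_
      have hv1 : v ∈ Icc (-1 : ℝ) 1 := by
        rw [mem_Icc, ← abs_le]
        have := abs_sub_left_of_mem_uIcc hv
        simp only [sub_zero] at this
        exact this.trans (abs_le.2 u.2)
      rw [IccExtend_of_mem _ _ hv1, IccExtend_of_mem _ _ (hsm ⟨v, hv1⟩)]
      rfl
    rw [← this, hc]
    simp
  refine ⟨ε, hεpos, fun t x => g (t, x) .one, fun t ht x => ?_, fun x => ?_, fun t ht x => ?_⟩
  · have h1 := contDiffAt_fixedPoint (contDiff_scaledPicard hV) hUo hhalf hL hg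
      (p := (t, x)) (abs_lt.2 ht)
    exact (ContinuousMap.evalCLM ℝ SymmInterval.one).contDiff.contDiffAt.comp _ h1
  · have h0 : ((0 : ℝ), x) ∈ U := by simpa [hU] using hεpos
    change g (0, x) .one = x
    rw [← hg _ h0, scaledPicard_apply]
    simp
  -- Taking `τ > |t|` puts `r / τ` in `[-1, 1]` for all `r` near `t`, so that nearby times are read
  -- off the single curve `g (τ, x)` and the fundamental theorem of calculus applies.
  · obtain ⟨τ, hτ1, hτ2⟩ := exists_between (abs_lt.2 ht)
    have hτ0 : 0 < τ := (abs_nonneg t).trans_lt hτ1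
    have hτU : |τ| < ε := by rwa [abs_of_pos hτ0]
    have hmem : ∀ r, |r| < τ → r / τ ∈ Icc (-1 : ℝ) 1 := fun r hr => by
      rw [mem_Icc, ← abs_le, abs_div, abs_of_pos hτ0, div_le_one hτ0]
      exact hr.le
    have hval : ∀ r, |r| < τ → g (r, x) .one =
        x + τ • ∫ u in (0 : ℝ)..r / τ, IccExtend neg_one_le_one_real (VC ∘ g (τ, x)) u := by
      intro r hr
      have h1 := hscale τ x hτU ⟨r / τ, hmem r hr⟩
      simp only [mul_div_cancel₀ r hτ0.ne'] at h1
      rw [h1, ← congrArg (fun γ => γ (⟨r / τ, hmem r hr⟩ : SymmInterval)) (hg (τ, x) hτU),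
        scaledPicard_apply]
    have hev : (fun r => g (r, x) .one) =ᶠ[nhds t] fun r =>
        x + τ • ∫ u in (0 : ℝ)..r / τ, IccExtend neg_one_le_one_real (VC ∘ g (τ, x)) u := by
      filter_upwards [(isOpen_lt continuous_abs continuous_const).mem_nhds hτ1] with r hr
        using hval r hr
    have hcont : Continuous (IccExtend neg_one_le_one_real (VC ∘ g (τ, x))) :=
      (VC.continuous.comp (g (τ, x)).continuous).Icc_extend'
    have hd1 := intervalIntegral.integral_hasDerivAt_right (hcont.intervalIntegrable 0 (t / τ))
      (hcont.stronglyMeasurableAtFilter _ _) hcont.continuousAt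
    have hd2 : HasDerivAt (fun r : ℝ => r / τ) (1 / τ) t := (hasDerivAt_id t).div_const τ
    have hd3 := ((hd1.scomp t hd2).const_smul τ).const_add x
    refine (hd3.congr_of_eventuallyEq hev).congr_deriv ?_
    rw [smul_smul, mul_one_div_cancel hτ0.ne', one_smul, IccExtend_of_mem _ _ (hmem t hτ1)]
    simp only [Function.comp_apply, hVC, ContinuousMap.coe_mk]
    rw [← hscale τ x hτU, mul_div_cancel₀ t hτ0.ne']

end Flow

theorem two_le_infty : (2 : WithTop ℕ∞) ≤ ∞ :=
  WithTop.coe_le_coe.2 (le_top : (2 : ℕ∞) ≤ ⊤)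

/-! ### Isotopies generated by time-dependent vector fields. -/

section Evolution

universe u

variable {E : Type u} [NormedAddCommGroup E] [NormedSpace ℝ E]

/-- `F t`, `|t| < ε`, is a smooth isotopy of `E` generated by the time-dependent field `X`, with
inverses `G t`. -/
structure IsEvolution (X : ℝ × E → E) (ε : ℝ) (F G : ℝ × E → E) : Prop where
  pos : 0 < ε
  contDiffAt : ∀ t ∈ Ioo (-ε) ε, ∀ x, ContDiffAt ℝ ∞ F (t, x)
  contDiffAt_inv : ∀ t ∈ Ioo (-ε) ε, ∀ x, ContDiffAt ℝ ∞ G (t, x)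
  zero : ∀ x, F (0, x) = x
  left_inv : ∀ t ∈ Ioo (-ε) ε, ∀ x, G (t, F (t, x)) = x
  right_inv : ∀ t ∈ Ioo (-ε) ε, ∀ x, F (t, G (t, x)) = x
  hasDerivAt : ∀ t ∈ Ioo (-ε) ε, ∀ x, HasDerivAt (fun s => F (s, x)) (X (t, F (t, x))) t

theorem exists_isEvolution [FiniteDimensional ℝ E] {X : ℝ × E → E} (hX : ContDiff ℝ ∞ X)
    (hc : HasCompactSupport X) : ∃ ε F G, IsEvolution X ε F G := by
  have : CompleteSpace E := FiniteDimensional.complete ℝ E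
  have hXL := ContDiff.lipschitzWith_of_hasCompactSupport hc hX (by simp)
  obtain ⟨K, hK⟩ := hXL
  -- Adding time as a coordinate makes the field autonomous.
  set V : ℝ × E → ℝ × E := fun p => (1, X p) with hV
  have hVs : ContDiff ℝ ∞ V := contDiff_const.prodMk hX
  have hVL : LipschitzWith K V := by
    refine LipschitzWith.of_dist_le_mul fun p q => ?_
    simpa [hV, Prod.dist_eq] using hK.dist_le_mul p q
  obtain ⟨ε, hε, φ, hs, h0, hd⟩ := exists_smooth_flow hVs hVL
  have hfst : ∀ t ∈ Ioo (-ε) ε, ∀ p, (φ t p).1 = p.1 + t := by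
    intro t ht p
    have := ODE_solution_unique_of_mem_Ioo (K := 0) (v := fun _ _ => (1 : ℝ))
      (s := fun _ => univ) (f := fun s => (φ s p).1) (g := fun s => p.1 + s) (t₀ := 0)
      (a := -ε) (b := ε) (fun _ _ => (LipschitzWith.const (1 : ℝ)).lipschitzOnWith)
      ⟨by linarith, hε⟩ (fun s hs => ⟨(hd s hs p).fst, trivial⟩)
      (fun s _ => ⟨(hasDerivAt_id s).const_add _, trivial⟩) (by simp [h0])
    exact this ht
  -- Both `s ↦ φ (-s) (φ t p)` and `s ↦ φ (t - s) p` solve the equation of `-V` with the same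
  -- initial value. Halving `ε` keeps `t - s` in the domain of the flow.
  have hgroup : ∀ t ∈ Ioo (-(ε / 2)) (ε / 2), ∀ p, φ (-t) (φ t p) = p := by
    intro t ht p
    have := ODE_solution_unique_of_mem_Ioo (K := K) (v := fun _ q => -V q)
      (s := fun _ => univ) (f := fun s => φ (-s) (φ t p)) (g := fun s => φ (t - s) p) (t₀ := 0)
      (a := -(ε / 2)) (b := ε / 2) (fun _ _ => hVL.neg.lipschitzOnWith)
      ⟨by linarith, by linarith⟩
      (fun s hs => ⟨by
        have h1 := (hd (-s) ⟨by linarith [hs.1, hs.2], by linarith [hs.1, hs.2]⟩ (φ t p))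
        exact (h1.scomp s (hasDerivAt_neg s)).congr_deriv (by simp), trivial⟩)
      (fun s hs => ⟨by
        have h1 := (hd (t - s) ⟨by linarith [hs.1, hs.2, ht.1, ht.2],
          by linarith [hs.1, hs.2, ht.1, ht.2]⟩ p)
        exact (h1.scomp s ((hasDerivAt_id s).const_sub t)).congr_deriv (by simp), trivial⟩)
      (by simp [h0])
    have h2 := this ht
    simp only [sub_self, h0] at h2
    exact h2
  have hsub : Ioo (-(ε / 2)) (ε / 2) ⊆ Ioo (-ε) ε := fun t ht =>
    ⟨by linarith [ht.1], by linarith [ht.2]⟩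
  have hneg : ∀ t ∈ Ioo (-(ε / 2)) (ε / 2), -t ∈ Ioo (-(ε / 2)) (ε / 2) := fun t ht =>
    ⟨by linarith [ht.2], by linarith [ht.1]⟩
  -- `F` flows from time 0 to time `t`; `G` starts at time `t` and flows back to time 0.
  refine ⟨ε / 2, fun p => (φ p.1 (0, p.2)).2, fun p => (φ (-p.1) (p.1, p.2)).2,
    by positivity, fun t ht x => ?_, fun t ht x => ?_, fun x => by simp [h0], fun t ht x => ?_,
    fun t ht x => ?_, fun t ht x => ?_⟩
  · have h1 := hs t (hsub ht) (0, x)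
    have h2 : ContDiffAt ℝ ∞ (fun p : ℝ × E => (p.1, ((0 : ℝ), p.2))) (t, x) := by fun_prop
    exact (ContDiffAt.comp (t, x) (g := fun p : ℝ × (ℝ × E) => φ p.1 p.2) h1 h2).snd
  · have h1 := hs (-t) (hsub (hneg t ht)) (t, x)
    have h2 : ContDiffAt ℝ ∞ (fun p : ℝ × E => (-p.1, (p.1, p.2))) (t, x) := by fun_prop
    exact (ContDiffAt.comp (t, x) (g := fun p : ℝ × (ℝ × E) => φ p.1 p.2)
      (f := fun p : ℝ × E => (-p.1, (p.1, p.2))) h1 h2).snd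
  · have h1 := hfst t (hsub ht) (0, x)
    have h2 : (t, (φ t (0, x)).2) = φ t (0, x) := Prod.ext (by simp [h1]) rfl
    simp only
    rw [h2, hgroup t ht]
  · have h1 := hfst (-t) (hsub (hneg t ht)) (t, x)
    have h2 : (0, (φ (-t) (t, x)).2) = φ (-t) (t, x) := Prod.ext (by simp [h1]) rfl
    simp only
    have h3 := hgroup (-t) (hneg t ht) (t, x)
    rw [neg_neg] at h3
    rw [h2, h3]
  · have h1 := hfst t (hsub ht) (0, x)
    have h2 := (hd t (hsub ht) (0, x)).snd
    have h3 : (t, (φ t (0, x)).2) = φ t (0, x) := Prod.ext (by simp [h1]) rfl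
    simp only
    rw [h3]
    exact h2

namespace IsEvolution

variable {X : ℝ × E → E} {ε : ℝ} {F G : ℝ × E → E}

theorem eq_of_hasDerivAt (h : IsEvolution X ε F G) {K : NNReal} (hX : LipschitzWith K X)
    {δ : ℝ} (hδ : 0 < δ) (hδε : δ ≤ ε) {γ : ℝ → E}
    (hγ : ∀ t ∈ Ioo (-δ) δ, HasDerivAt γ (X (t, γ t)) t) {t : ℝ} (ht : t ∈ Ioo (-δ) δ) :
    F (t, γ 0) = γ t := by
  have hL : ∀ t, LipschitzWith K fun x => X (t, x) := fun t => by
    refine LipschitzWith.of_dist_le_mul fun x y => ?_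
    simpa [Prod.dist_eq] using hX.dist_le_mul (t, x) (t, y)
  exact ODE_solution_unique_of_mem_Ioo (K := K) (v := fun t x => X (t, x))
    (s := fun _ => univ) (f := fun s => F (s, γ 0)) (g := γ) (t₀ := 0)
    (fun t _ => (hL t).lipschitzOnWith) ⟨by linarith, hδ⟩
    (fun s hs => ⟨h.hasDerivAt s ⟨by linarith [hs.1], by linarith [hs.2]⟩ _, trivial⟩)
    (fun s hs => ⟨hγ s hs, trivial⟩) (h.zero _) ht

theorem eq_self (h : IsEvolution X ε F G) {K : NNReal} (hX : LipschitzWith K X) {x : E} {δ : ℝ}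
    (hδ : 0 < δ) (hδε : δ ≤ ε) (hx : ∀ t ∈ Ioo (-δ) δ, X (t, x) = 0) {t : ℝ}
    (ht : t ∈ Ioo (-δ) δ) : F (t, x) = x :=
  h.eq_of_hasDerivAt hX hδ hδε (γ := fun _ => x)
    (fun t ht => by simpa [hx t ht] using hasDerivAt_const t x) ht

theorem hasFDerivAt (h : IsEvolution X ε F G) {s : ℝ} (hs : s ∈ Ioo (-ε) ε) (x : E) :
    HasFDerivAt F (fderiv ℝ F (s, x)) (s, x) :=
  ((h.contDiffAt s hs x).differentiableAt (by simp)).hasFDerivAt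

theorem fderiv_apply_time (h : IsEvolution X ε F G) {s : ℝ} (hs : s ∈ Ioo (-ε) ε) (x : E) :
    fderiv ℝ F (s, x) (1, 0) = X (s, F (s, x)) := by
  have h1 : HasDerivAt (fun r : ℝ => (r, x)) ((1 : ℝ), (0 : E)) s :=
    (hasDerivAt_id s).prodMk (hasDerivAt_const s x)
  exact ((h.hasFDerivAt hs x).comp_hasDerivAt s h1).unique (h.hasDerivAt s hs x)

/-- The variational equation. -/
theorem fderiv_fderiv_apply (h : IsEvolution X ε F G) (hX : Differentiable ℝ X) {s : ℝ}
    (hs : s ∈ Ioo (-ε) ε) (x v : E) :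
    fderiv ℝ (fderiv ℝ F) (s, x) (0, v) (1, 0) =
      fderiv ℝ X (s, F (s, x)) (0, fderiv ℝ F (s, x) (0, v)) := by
  have hD2 : HasFDerivAt (fderiv ℝ F) (fderiv ℝ (fderiv ℝ F) (s, x)) (s, x) :=
    (((h.contDiffAt s hs x).fderiv_right (m := ∞) (by simp)).differentiableAt (by simp)).hasFDerivAt
  have e1 : HasFDerivAt (fun p => fderiv ℝ F p (1, 0))
      ((fderiv ℝ (fderiv ℝ F) (s, x)).flip (1, 0)) (s, x) :=
    ((ContinuousLinearMap.apply ℝ E ((1 : ℝ), (0 : E))).hasFDerivAt).comp (s, x) hD2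
  have e2 : HasFDerivAt (fun p : ℝ × E => X (p.1, F p))
      (fderiv ℝ X (s, F (s, x)) ∘L (ContinuousLinearMap.fst ℝ ℝ E).prod (fderiv ℝ F (s, x)))
      (s, x) := by
    have : HasFDerivAt (fun p : ℝ × E => (p.1, F p))
        ((ContinuousLinearMap.fst ℝ ℝ E).prod (fderiv ℝ F (s, x))) (s, x) :=
      hasFDerivAt_fst.prodMk (h.hasFDerivAt hs x)
    exact (hX (s, F (s, x))).hasFDerivAt.comp (s, x) this
  have e3 : (fun p => fderiv ℝ F p (1, 0)) =ᶠ[nhds (s, x)] fun p : ℝ × E => X (p.1, F p) := by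
    filter_upwards [(isOpen_Ioo.preimage continuous_fst).mem_nhds
      (show (s, x) ∈ Prod.fst ⁻¹' Ioo (-ε) ε from hs)] with p hp
      using h.fderiv_apply_time hp p.2
  exact (DFunLike.congr_fun ((e2.congr_of_eventuallyEq e3).unique e1) ((0 : ℝ), v)).symm

/-- If the Lie derivative of the 1-form `A` along `X` is a multiple of `A`, then the evolution of
`X` preserves the kernel of `A`. -/
theorem apply_fderiv_eq_zero_iff (h : IsEvolution X ε F G) (hX : Differentiable ℝ X) {V : Set E}
    (hV : IsOpen V)
    {A : E → E →L[ℝ] ℝ} (hA : ContDiffOn ℝ ∞ A V) {g : ℝ × E → ℝ} {C : NNReal}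
    (hg : ∀ p, ‖g p‖ ≤ C)
    (hLie : ∀ t, ∀ p ∈ V, ∀ v, fderiv ℝ A p (X (t, p)) v + A p (fderiv ℝ X (t, p) (0, v)) =
      g (t, p) * A p v) {x : E} (hx : ∀ t ∈ Ioo (-ε) ε, F (t, x) ∈ V) {t : ℝ}
    (ht : t ∈ Ioo (-ε) ε) (v : E) :
    A (F (t, x)) (fderiv ℝ F (t, x) (0, v)) = 0 ↔ A x v = 0 := by
  set y : ℝ → ℝ := fun s => A (F (s, x)) (fderiv ℝ F (s, x) (0, v)) with hy
  -- The variational equation and the hypothesis on the Lie derivative give the scalar linear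
  -- equation `y' = g y`, whose solutions vanish either everywhere or nowhere.
  have hy' : ∀ s ∈ Ioo (-ε) ε, HasDerivAt y (g (s, F (s, x)) * y s) s := by
    intro s hs
    have hline : HasDerivAt (fun r : ℝ => (r, x)) ((1 : ℝ), (0 : E)) s :=
      (hasDerivAt_id s).prodMk (hasDerivAt_const s x)
    have hF2 : ContDiffAt ℝ ∞ (fderiv ℝ F) (s, x) :=
      (h.contDiffAt s hs x).fderiv_right (by simp)
    have hD2 : HasFDerivAt (fderiv ℝ F) (fderiv ℝ (fderiv ℝ F) (s, x)) (s, x) :=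
      (hF2.differentiableAt (by simp)).hasFDerivAt
    have hsymm : fderiv ℝ (fderiv ℝ F) (s, x) (1, 0) (0, v) =
        fderiv ℝ (fderiv ℝ F) (s, x) (0, v) (1, 0) :=
      ((h.contDiffAt s hs x).isSymmSndFDerivAt (by simpa using two_le_infty)) (1, 0) (0, v)
    have hmixed := h.fderiv_fderiv_apply hX hs x v
    have hder1 : HasDerivAt (fun r => fderiv ℝ F (r, x) (0, v))
        (fderiv ℝ X (s, F (s, x)) (0, fderiv ℝ F (s, x) (0, v))) s := by
      rw [← hmixed, ← hsymm]
      exact (ContinuousLinearMap.apply ℝ E ((0 : ℝ), v)).hasFDerivAt.comp_hasDerivAt s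
        (hD2.comp_hasDerivAt s hline)
    have hder2 : HasDerivAt (fun r => A (F (r, x))) (fderiv ℝ A (F (s, x)) (X (s, F (s, x)))) s :=
      ((hA.contDiffAt (hV.mem_nhds (hx s hs))).differentiableAt
        (by simp)).hasFDerivAt.comp_hasDerivAt s (h.hasDerivAt s hs x)
    refine (hder2.clm_apply hder1).congr_deriv ?_
    exact hLie s _ (hx s hs) _
  have hy0 : y 0 = A x v := by
    have h00 : (0 : ℝ) ∈ Ioo (-ε) ε := ⟨by linarith [h.pos], h.pos⟩
    have h1 : HasFDerivAt (fun z : E => F (0, z)) (fderiv ℝ F (0, x) ∘L .inr ℝ ℝ E) x :=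
      (h.hasFDerivAt h00 x).comp x (hasFDerivAt_prodMk_right 0 x)
    have h2 : (fun z : E => F (0, z)) = id := funext h.zero
    rw [h2] at h1
    have h3 := congrArg (fun L => L v) (h1.unique (hasFDerivAt_id x))
    simp only [ContinuousLinearMap.comp_apply, ContinuousLinearMap.inr_apply,
      ContinuousLinearMap.id_apply] at h3
    simp only [hy, h.zero, h3]
  have key : ∀ t₀ ∈ Ioo (-ε) ε, y t₀ = 0 → EqOn y (fun _ => 0) (Ioo (-ε) ε) := by
    intro t₀ ht₀ h0
    refine ODE_solution_unique_of_mem_Ioo (K := C) (v := fun t r => g (t, F (t, x)) * r)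
      (s := fun _ => univ) (t₀ := t₀) (fun s _ => ?_) ht₀
      (fun s hs => ⟨hy' s hs, trivial⟩)
      (fun s hs => ⟨by simpa using hasDerivAt_const s (0 : ℝ), trivial⟩) h0
    refine (LipschitzWith.of_dist_le_mul fun a b => ?_).lipschitzOnWith
    rw [dist_eq_norm, ← mul_sub, norm_mul, dist_eq_norm]
    exact mul_le_mul_of_nonneg_right (hg _) (norm_nonneg _)
  rw [← hy0]
  exact ⟨fun h1 => key t ht h1 ⟨by linarith [h.pos], h.pos⟩,
    fun h1 => key 0 ⟨by linarith [h.pos], h.pos⟩ h1 ht⟩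

end IsEvolution

end Evolution

/-! ### Linear algebra of the contact condition. -/

section LinearAlgebra

theorem E3.eq_sum (u : E3) : u = u 0 • EuclideanSpace.single 0 (1 : ℝ) +
    u 1 • EuclideanSpace.single 1 (1 : ℝ) + u 2 • EuclideanSpace.single 2 (1 : ℝ) := by
  ext i
  fin_cases i <;> simp

/-- The value of `a ∧ b` on three vectors. -/
noncomputable def wedge (a : E3 →L[ℝ] ℝ) (b : E3 →L[ℝ] E3 →L[ℝ] ℝ) (u v w : E3) : ℝ :=
  a u * b v w - a v * b u w + a w * b u v

/-- Contracting the zero 4-form `b ∧ b` with `W` gives `g a ∧ b = 0`, hence `g = 0`. Then the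
contraction of `a ∧ b` with `W` is `a(W) b - a ∧ b(W, ·) = 0`, hence `W = 0`. The linear
combinations below are the coordinates of these two identities. -/
theorem eq_zero_of_wedge_ne_zero {a : E3 →L[ℝ] ℝ} {b : E3 →L[ℝ] E3 →L[ℝ] ℝ}
    (hb : ∀ u v, b u v = -b v u) {u v w : E3} (h : wedge a b u v w ≠ 0) {W : E3} {g : ℝ}
    (h1 : a W = 0) (h2 : ∀ z, b W z = g * a z) : W = 0 ∧ g = 0 := by
  set e : Fin 3 → E3 := fun i => EuclideanSpace.single i (1 : ℝ) with he
  have hs : ∀ u : E3, u = u 0 • e 0 + u 1 • e 1 + u 2 • e 2 := E3.eq_sum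
  have ha : ∀ u : E3, a u = u 0 * a (e 0) + u 1 * a (e 1) + u 2 * a (e 2) := fun u => by
    conv_lhs => rw [hs u]
    simp
  have hd : ∀ i, b (e i) (e i) = 0 := fun i => by linarith [hb (e i) (e i)]
  have hbb : ∀ u v : E3, b u v = (u 0 * v 1 - u 1 * v 0) * b (e 0) (e 1) +
      (u 0 * v 2 - u 2 * v 0) * b (e 0) (e 2) + (u 1 * v 2 - u 2 * v 1) * b (e 1) (e 2) := by
    intro u v
    conv_lhs => rw [hs u, hs v]
    simp only [map_add, map_smul, add_apply, smul_apply,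
      smul_eq_mul, hd, hb (e 1) (e 0), hb (e 2) (e 0), hb (e 2) (e 1)]
    ring
  set a0 := a (e 0)
  set a1 := a (e 1)
  set a2 := a (e 2)
  set b01 := b (e 0) (e 1)
  set b02 := b (e 0) (e 2)
  set b12 := b (e 1) (e 2)
  have hD : a0 * b12 - a1 * b02 + a2 * b01 ≠ 0 := by
    intro h0
    apply h
    rw [wedge, ha u, ha v, ha w, hbb v w, hbb u w, hbb u v]
    linear_combination (u 0 * (v 1 * w 2 - v 2 * w 1) - u 1 * (v 0 * w 2 - v 2 * w 0)
      + u 2 * (v 0 * w 1 - v 1 * w 0)) * h0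
  have k0 := h2 (e 0)
  have k1 := h2 (e 1)
  have k2 := h2 (e 2)
  rw [hbb] at k0 k1 k2
  have v00 : e 0 0 = 1 := by simp [he]
  have v01 : e 0 1 = 0 := by simp [he]
  have v02 : e 0 2 = 0 := by simp [he]
  have v10 : e 1 0 = 0 := by simp [he]
  have v11 : e 1 1 = 1 := by simp [he]
  have v12 : e 1 2 = 0 := by simp [he]
  have v20 : e 2 0 = 0 := by simp [he]
  have v21 : e 2 1 = 0 := by simp [he]
  have v22 : e 2 2 = 1 := by simp [he]
  rw [v00, v01, v02] at k0
  rw [v10, v11, v12] at k1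
  rw [v20, v21, v22] at k2
  rw [ha W] at h1
  change _ = g * a0 at k0
  change _ = g * a1 at k1
  change _ = g * a2 at k2
  have hg : g = 0 := by
    have : g * (a0 * b12 - a1 * b02 + a2 * b01) = 0 := by
      linear_combination (-b12) * k0 + b02 * k1 - b01 * k2
    exact (mul_eq_zero.1 this).resolve_right hD
  subst hg
  simp only [zero_mul] at k0 k1 k2
  refine ⟨?_, rfl⟩
  have w0 : W 0 = 0 := by
    have : W 0 * (a0 * b12 - a1 * b02 + a2 * b01) = 0 := by
      linear_combination b12 * h1 - a1 * k2 + a2 * k1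
    exact (mul_eq_zero.1 this).resolve_right hD
  have w1 : W 1 = 0 := by
    have : W 1 * (a0 * b12 - a1 * b02 + a2 * b01) = 0 := by
      linear_combination -b02 * h1 + a0 * k2 - a2 * k0
    exact (mul_eq_zero.1 this).resolve_right hD
  have w2 : W 2 = 0 := by
    have : W 2 * (a0 * b12 - a1 * b02 + a2 * b01) = 0 := by
      linear_combination b01 * h1 - a0 * k1 + a1 * k0
    exact (mul_eq_zero.1 this).resolve_right hD
  rw [hs W, w0, w1, w2]
  simp

/-- The linear map `(W, g) ↦ (b(W, ·) - g a, a(W))`. -/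
noncomputable def contactMap (a : E3 →L[ℝ] ℝ) (b : E3 →L[ℝ] E3 →L[ℝ] ℝ) :
    E3 × ℝ →L[ℝ] (E3 →L[ℝ] ℝ) × ℝ :=
  (b ∘L .fst ℝ E3 ℝ - (ContinuousLinearMap.snd ℝ E3 ℝ).smulRight a).prod (a ∘L .fst ℝ E3 ℝ)

theorem contactMap_apply (a : E3 →L[ℝ] ℝ) (b : E3 →L[ℝ] E3 →L[ℝ] ℝ) (x : E3 × ℝ) :
    contactMap a b x = (b x.1 - x.2 • a, a x.1) := rfl

theorem contactMap_isInvertible {a : E3 →L[ℝ] ℝ} {b : E3 →L[ℝ] E3 →L[ℝ] ℝ}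
    (hb : ∀ u v, b u v = -b v u) {u v w : E3} (h : wedge a b u v w ≠ 0) :
    (contactMap a b).IsInvertible := by
  have hinj : Function.Injective (contactMap a b).toLinearMap := by
    rw [← LinearMap.ker_eq_bot, LinearMap.ker_eq_bot']
    rintro ⟨W, g⟩ hW
    have hW' : (b W - g • a, a W) = (0, 0) := hW
    rw [Prod.mk.injEq] at hW'
    obtain ⟨h1, h2⟩ := hW'
    have := eq_zero_of_wedge_ne_zero hb h h2 (g := g) fun z => by
      have := DFunLike.congr_fun h1 z
      simp only [sub_apply, smul_apply, smul_eq_mul,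
        zero_apply] at this
      linarith
    exact Prod.ext this.1 this.2
  have hrank : Module.finrank ℝ (E3 × ℝ) = Module.finrank ℝ ((E3 →L[ℝ] ℝ) × ℝ) := by
    rw [Module.finrank_prod, Module.finrank_prod]
    congr 1
    rw [← (LinearMap.toContinuousLinearMap (𝕜 := ℝ) (E := E3) (F' := ℝ)).finrank_eq]
    exact Subspace.dual_finrank_eq.symm
  refine ⟨(LinearEquiv.ofInjectiveOfFinrankEq _ hinj hrank).toContinuousLinearEquiv, ?_⟩
  exact ContinuousLinearMap.ext fun x => rfl

end LinearAlgebra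

/-! ### Contact vector fields and their Hamiltonians. -/

section ContactForm

/-- The exterior derivative of a 1-form on `ℝ³`, as a bilinear form. -/
noncomputable def extd (A : E3 → E3 →L[ℝ] ℝ) (p : E3) : E3 →L[ℝ] E3 →L[ℝ] ℝ :=
  fderiv ℝ A p - (fderiv ℝ A p).flip

theorem extd_apply (A : E3 → E3 →L[ℝ] ℝ) (p u v : E3) :
    extd A p u v = fderiv ℝ A p u v - fderiv ℝ A p v u := rfl

/-- `A` is a contact form on the open subset `V` of `ℝ³`. -/
structure IsContactForm (A : E3 → E3 →L[ℝ] ℝ) (V : Set E3) : Prop where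
  isOpen : IsOpen V
  contDiffOn : ContDiffOn ℝ ∞ A V
  wedge_ne_zero : ∀ p ∈ V, ∃ u v w, wedge (A p) (extd A p) u v w ≠ 0

/-- The solution `(X, g)` of `dA(X, ·) + d_x H = g A`, `A(X) = H`. -/
noncomputable def contactField (A : E3 → E3 →L[ℝ] ℝ) (H : ℝ × E3 → ℝ) (q : ℝ × E3) : E3 × ℝ :=
  (contactMap (A q.2) (extd A q.2)).inverse (-(fderiv ℝ H q ∘L .inr ℝ ℝ E3), H q)

namespace IsContactForm

variable {A : E3 → E3 →L[ℝ] ℝ} {V : Set E3}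

theorem contDiffAt (hA : IsContactForm A V) {p : E3} (hp : p ∈ V) : ContDiffAt ℝ ∞ A p :=
  hA.contDiffOn.contDiffAt (hA.isOpen.mem_nhds hp)

theorem contDiffAt_extd (hA : IsContactForm A V) {p : E3} (hp : p ∈ V) :
    ContDiffAt ℝ ∞ (extd A) p := by
  have h1 : ContDiffAt ℝ ∞ (fderiv ℝ A) p := (hA.contDiffAt hp).fderiv_right (by simp)
  have h2 : ContDiff ℝ ∞ fun f : E3 →L[ℝ] E3 →L[ℝ] ℝ => f.flip := by
    refine contDiff_clm_apply_iff.2 fun v => contDiff_clm_apply_iff.2 fun w => ?_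
    simp only [ContinuousLinearMap.flip_apply]
    fun_prop
  exact h1.sub (h2.contDiffAt.comp p h1)

theorem isInvertible (hA : IsContactForm A V) {p : E3} (hp : p ∈ V) :
    (contactMap (A p) (extd A p)).IsInvertible := by
  obtain ⟨u, v, w, h⟩ := hA.wedge_ne_zero p hp
  exact contactMap_isInvertible (fun u v => by rw [extd_apply, extd_apply]; ring) h

theorem contactMap_contactField (hA : IsContactForm A V) (H : ℝ × E3 → ℝ) {q : ℝ × E3}
    (hq : q.2 ∈ V) : contactMap (A q.2) (extd A q.2) (contactField A H q) =
      (-(fderiv ℝ H q ∘L .inr ℝ ℝ E3), H q) :=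
  (hA.isInvertible hq).self_apply_inverse _

theorem apply_contactField (hA : IsContactForm A V) (H : ℝ × E3 → ℝ) {q : ℝ × E3}
    (hq : q.2 ∈ V) : A q.2 (contactField A H q).1 = H q :=
  congrArg Prod.snd (hA.contactMap_contactField H hq)

theorem extd_contactField (hA : IsContactForm A V) (H : ℝ × E3 → ℝ) {q : ℝ × E3}
    (hq : q.2 ∈ V) (v : E3) : extd A q.2 (contactField A H q).1 v -
      (contactField A H q).2 * A q.2 v = -fderiv ℝ H q (0, v) :=
  DFunLike.congr_fun (congrArg Prod.fst (hA.contactMap_contactField H hq)) v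

/-- Only the value and the spatial differential of `H` at `q` enter, and the multiplier `g` is free.
This is how a 1-jet prescribed along a curve prescribes the field along the curve. -/
theorem contactField_eq (hA : IsContactForm A V) (H : ℝ × E3 → ℝ) {q : ℝ × E3}
    (hq : q.2 ∈ V) {W : E3} {g : ℝ} (h1 : A q.2 W = H q)
    (h2 : ∀ v, fderiv ℝ H q (0, v) = g * A q.2 v - extd A q.2 W v) :
    (contactField A H q).1 = W := by
  have h : contactMap (A q.2) (extd A q.2) (W, g) = (-(fderiv ℝ H q ∘L .inr ℝ ℝ E3), H q) := by
    rw [contactMap_apply, h1, Prod.mk.injEq]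
    refine ⟨?_, rfl⟩
    ext v
    have := h2 v
    simp only [sub_apply, smul_apply, smul_eq_mul,
      neg_apply, ContinuousLinearMap.comp_apply, ContinuousLinearMap.inr_apply]
    linarith
  rw [contactField, ← h, (hA.isInvertible hq).inverse_apply_self]

theorem contDiffOn_contactMap (hA : IsContactForm A V) :
    ContDiffOn ℝ ∞ (fun p => contactMap (A p) (extd A p)) V := by
  refine contDiffOn_clm_apply.2 fun z => ?_
  have h1 : ContDiffOn ℝ ∞ (fun p => extd A p z.1) V := fun p hp =>
    ((hA.contDiffAt_extd hp).contDiffWithinAt).clm_apply contDiffWithinAt_const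
  have h2 : ContDiffOn ℝ ∞ (fun p => A p z.1) V := hA.contDiffOn.clm_apply contDiffOn_const
  exact (h1.sub (contDiffOn_const.smul hA.contDiffOn)).prodMk h2

theorem contDiffAt_contactField (hA : IsContactForm A V) {H : ℝ × E3 → ℝ} {q : ℝ × E3}
    (hq : q.2 ∈ V) (hH : ContDiffAt ℝ ∞ H q) : ContDiffAt ℝ ∞ (contactField A H) q := by
  have hm : ContDiffAt ℝ ∞ (fun q : ℝ × E3 => contactMap (A q.2) (extd A q.2)) q :=
    ContDiffAt.comp q (g := fun p => contactMap (A p) (extd A p)) (f := Prod.snd)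
      (hA.contDiffOn_contactMap.contDiffAt (hA.isOpen.mem_nhds hq)) contDiffAt_snd
  have hdH : ContDiffAt ℝ ∞ (fun q => fderiv ℝ H q ∘L .inr ℝ ℝ E3) q :=
    (hH.fderiv_right (m := ∞) (by simp)).clm_comp contDiffAt_const
  exact ((hA.isInvertible hq).contDiffAt_map_inverse.comp q hm).clm_apply (hdH.neg.prodMk hH)

/-- No invertibility is needed: the right-hand side is zero off the support, and `inverse` is a
linear map in every case. The field thus extends by zero to points where `A` is not a contact form.
-/
theorem contactField_eq_zero (A : E3 → E3 →L[ℝ] ℝ) {H : ℝ × E3 → ℝ} {q : ℝ × E3}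
    (hq : q ∉ tsupport H) : contactField A H q = 0 := by
  have h1 : fderiv ℝ H q = 0 := by
    by_contra h
    exact hq (support_fderiv_subset ℝ h)
  have h2 : H q = 0 := image_eq_zero_of_notMem_tsupport hq
  rw [contactField, h1, h2, ContinuousLinearMap.zero_comp, neg_zero]
  exact map_zero _

theorem tsupport_contactField_subset (A : E3 → E3 →L[ℝ] ℝ) (H : ℝ × E3 → ℝ) :
    tsupport (contactField A H) ⊆ tsupport H :=
  closure_minimal (fun q hq => by
    by_contra h
    exact hq (contactField_eq_zero A h)) (isClosed_tsupport H)

theorem contDiff_contactField (hA : IsContactForm A V) {H : ℝ × E3 → ℝ}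
    (hH : ContDiff ℝ ∞ H) (hs : ∀ q ∈ tsupport H, q.2 ∈ V) :
    ContDiff ℝ ∞ (contactField A H) := by
  rw [contDiff_iff_contDiffAt]
  intro q
  by_cases hq : q ∈ tsupport H
  · exact hA.contDiffAt_contactField (hs q hq) hH.contDiffAt
  · have : contactField A H =ᶠ[nhds q] fun _ => 0 := by
      filter_upwards [(isClosed_tsupport H).isOpen_compl.mem_nhds hq] with r hr
        using contactField_eq_zero A hr
    exact contDiffAt_const.congr_of_eventuallyEq this

/-- Cartan's formula: differentiating `A(X) = H` in the direction `v` and adding the equation for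
`dA(X, v)` cancels `dH` and the unwanted derivative of `A`. -/
theorem lie_contactField (hA : IsContactForm A V) {H : ℝ × E3 → ℝ}
    (hH : ContDiff ℝ ∞ H) (hs : ∀ q ∈ tsupport H, q.2 ∈ V) (t : ℝ) {p : E3} (hp : p ∈ V) (v : E3) :
    fderiv ℝ A p (contactField A H (t, p)).1 v +
      A p (fderiv ℝ (fun q => (contactField A H q).1) (t, p) (0, v)) =
      (contactField A H (t, p)).2 * A p v := by
  have hX : DifferentiableAt ℝ (fun q => (contactField A H q).1) (t, p) :=
    ((hA.contDiff_contactField hH hs).fst.differentiable (by simp)) _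
  have hAd : HasFDerivAt A (fderiv ℝ A p) p :=
    ((hA.contDiffAt hp).differentiableAt (by simp)).hasFDerivAt
  have e1 : HasFDerivAt (fun z : E3 => (contactField A H (t, z)).1)
      (fderiv ℝ (fun q => (contactField A H q).1) (t, p) ∘L .inr ℝ ℝ E3) p :=
    HasFDerivAt.comp (g := fun q => (contactField A H q).1) p hX.hasFDerivAt
      (hasFDerivAt_prodMk_right t p)
  have e2 := hAd.clm_apply e1
  have e3 : HasFDerivAt (fun z : E3 => H (t, z)) (fderiv ℝ H (t, p) ∘L .inr ℝ ℝ E3) p :=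
    (hH.differentiable (by simp) (t, p)).hasFDerivAt.comp p (hasFDerivAt_prodMk_right t p)
  have e4 : (fun z : E3 => A z (contactField A H (t, z)).1) =ᶠ[nhds p] fun z => H (t, z) := by
    filter_upwards [hA.isOpen.mem_nhds hp] with z hz using hA.apply_contactField H (q := (t, z)) hz
  have e5 := DFunLike.congr_fun ((e3.congr_of_eventuallyEq e4).unique e2) v
  have e6 := hA.extd_contactField H (q := (t, p)) hp v
  rw [extd_apply] at e6
  simp only [ContinuousLinearMap.comp_apply, ContinuousLinearMap.inr_apply,
    add_apply, ContinuousLinearMap.flip_apply] at e5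
  simp only at e6
  linarith

end IsContactForm

end ContactForm

/-! ### Inverting families of increasing functions. -/

section Inverse

/-- The shear `(x, y) ↦ (x, c x + d y)`. -/
noncomputable def shearEquiv (c d : ℝ) (hd : d ≠ 0) : (ℝ × ℝ) ≃L[ℝ] ℝ × ℝ :=
  ContinuousLinearEquiv.equivOfInverse
    ((ContinuousLinearMap.fst ℝ ℝ ℝ).prod
      (c • ContinuousLinearMap.fst ℝ ℝ ℝ + d • ContinuousLinearMap.snd ℝ ℝ ℝ))
    ((ContinuousLinearMap.fst ℝ ℝ ℝ).prod
      (d⁻¹ • (ContinuousLinearMap.snd ℝ ℝ ℝ - c • ContinuousLinearMap.fst ℝ ℝ ℝ)))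
    (fun x => by ext <;> simp [hd])
    (fun x => by ext <;> simp [hd])

/-- A smooth family of increasing functions has a smooth family of inverses. -/
theorem exists_smooth_inverse {f : ℝ × ℝ → ℝ} {ε a b : ℝ}
    (hf : ContDiffOn ℝ ∞ f (Ioo (-ε) ε ×ˢ Ioo a b))
    (hpos : ∀ x ∈ Ioo (-ε) ε ×ˢ Ioo a b, 0 < fderiv ℝ f x (0, 1)) :
    ∃ (T : Set (ℝ × ℝ)) (κ : ℝ × ℝ → ℝ × ℝ), IsOpen T ∧ ContDiffOn ℝ ∞ κ T ∧
      (∀ z ∈ T, κ z ∈ Ioo (-ε) ε ×ˢ Ioo a b ∧ (κ z).1 = z.1) ∧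
      ∀ x ∈ Ioo (-ε) ε ×ˢ Ioo a b, (x.1, f x) ∈ T ∧ κ (x.1, f x) = x := by
  set S := Ioo (-ε) ε ×ˢ Ioo a b with hS
  have hSo : IsOpen S := isOpen_Ioo.prod isOpen_Ioo
  set G : ℝ × ℝ → ℝ × ℝ := fun x => (x.1, f x) with hG
  have hfa : ∀ x ∈ S, ContDiffAt ℝ ∞ f x := fun x hx => hf.contDiffAt (hSo.mem_nhds hx)
  have hGa : ∀ x ∈ S, ContDiffAt ℝ ∞ G x := fun x hx => contDiffAt_fst.prodMk (hfa x hx)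
  have hinj : InjOn G S := by
    rintro ⟨t, s⟩ hx ⟨t', s'⟩ hx' h
    obtain ⟨rfl, h2⟩ : t = t' ∧ f (t, s) = f (t', s') := by simpa [hG] using h
    have hd : ∀ r ∈ Ioo a b, HasDerivAt (fun r => f (t, r)) (fderiv ℝ f (t, r) (0, 1)) r := by
      intro r hr
      exact ((hfa (t, r) ⟨hx.1, hr⟩).differentiableAt
        (by simp)).hasFDerivAt.comp_hasDerivAt r ((hasDerivAt_const r t).prodMk (hasDerivAt_id r))
    have hmono : StrictMonoOn (fun r => f (t, r)) (Ioo a b) := by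
      refine strictMonoOn_of_deriv_pos (convex_Ioo a b)
        (fun r hr => (hd r hr).continuousAt.continuousWithinAt) fun r hr => ?_
      rw [interior_Ioo] at hr
      rw [(hd r hr).deriv]
      exact hpos (t, r) ⟨hx.1, hr⟩
    exact congrArg (Prod.mk t) (hmono.injOn hx.2 hx'.2 h2)
  have hder : ∀ x ∈ S, ∃ L : (ℝ × ℝ) ≃L[ℝ] ℝ × ℝ, HasFDerivAt G (L : ℝ × ℝ →L[ℝ] ℝ × ℝ) x := by
    intro x hx
    refine ⟨shearEquiv (fderiv ℝ f x (1, 0)) (fderiv ℝ f x (0, 1)) (hpos x hx).ne', ?_⟩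
    have h1 : HasFDerivAt G ((ContinuousLinearMap.fst ℝ ℝ ℝ).prod (fderiv ℝ f x)) x :=
      hasFDerivAt_fst.prodMk ((hfa x hx).differentiableAt (by simp)).hasFDerivAt
    convert h1 using 1
    ext <;> simp [shearEquiv]
  choose! L hL using hder
  -- The map `(t, s) ↦ (t, f (t, s))` is injective by strict monotonicity in `s`, and its derivative
  -- is an invertible shear, so the inverse function theorem makes the image open and the inverse
  -- smooth.
  refine ⟨G '' S, Function.invFunOn G S, ?_, ?_, ?_, ?_⟩
  · rw [isOpen_iff_mem_nhds]
    rintro _ ⟨x, hx, rfl⟩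
    rw [← ((hGa x hx).hasStrictFDerivAt' (hL x hx) (by simp)).map_nhds_eq_of_equiv]
    exact Filter.image_mem_map (hSo.mem_nhds hx)
  · rintro _ ⟨x, hx, rfl⟩
    refine ContDiffAt.contDiffWithinAt ?_
    have hst := (hGa x hx).hasStrictFDerivAt' (hL x hx) (by simp)
    have h1 : ContDiffAt ℝ ∞ (hst.localInverse G (L x) x) (G x) :=
      (hGa x hx).to_localInverse (hL x hx) (by simp)
    refine h1.congr_of_eventuallyEq ?_
    have h2 := hst.localInverse_tendsto.eventually (hSo.mem_nhds hx)
    filter_upwards [h2, hst.eventually_right_inverse] with y hy1 hy2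
    have hmem : y ∈ G '' S := ⟨_, hy1, hy2⟩
    exact hinj (Function.invFunOn_mem hmem) hy1 ((Function.invFunOn_eq hmem).trans hy2.symm)
  · rintro z hz
    have hz' : G (Function.invFunOn G S z) = z := Function.invFunOn_eq hz
    exact ⟨Function.invFunOn_mem hz, (Prod.ext_iff.1 hz').1⟩
  · intro x hx
    have hmem : G x ∈ G '' S := mem_image_of_mem _ hx
    exact ⟨hmem, hinj (Function.invFunOn_mem hmem) hx (Function.invFunOn_eq hmem)⟩

end Inverse

/-! ### A contact Hamiltonian for a moving curve. -/

section Hamiltonian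

/-- A smooth family of curves `γ t`, `|t| < ε`, in the domain of a contact form, all Legendrian or
all transverse, along which the linear functional `ℓ` increases. -/
structure IsCurveFamily (A : E3 → E3 →L[ℝ] ℝ) (V : Set E3) (γ : ℝ × ℝ → E3) (ε a b : ℝ)
    (ℓ : E3 →L[ℝ] ℝ) : Prop where
  contactForm : IsContactForm A V
  pos : 0 < ε
  contDiffOn : ContDiffOn ℝ ∞ γ (Ioo (-ε) ε ×ˢ Ioo a b)
  mem : ∀ x ∈ Ioo (-ε) ε ×ˢ Ioo a b, γ x ∈ V
  increasing : ∀ x ∈ Ioo (-ε) ε ×ˢ Ioo a b, 0 < ℓ (fderiv ℝ γ x (0, 1))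
  contact : (∀ x ∈ Ioo (-ε) ε ×ˢ Ioo a b, A (γ x) (fderiv ℝ γ x (0, 1)) = 0) ∨
    ∀ x ∈ Ioo (-ε) ε ×ˢ Ioo a b, A (γ x) (fderiv ℝ γ x (0, 1)) ≠ 0

namespace IsCurveFamily

variable {A : E3 → E3 →L[ℝ] ℝ} {V : Set E3} {γ : ℝ × ℝ → E3} {ε a b : ℝ} {ℓ : E3 →L[ℝ] ℝ}

theorem contDiffAt (h : IsCurveFamily A V γ ε a b ℓ) {x : ℝ × ℝ}
    (hx : x ∈ Ioo (-ε) ε ×ˢ Ioo a b) : ContDiffAt ℝ ∞ γ x :=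
  h.contDiffOn.contDiffAt ((isOpen_Ioo.prod isOpen_Ioo).mem_nhds hx)

theorem contDiffAt_fderiv_apply (h : IsCurveFamily A V γ ε a b ℓ) {x : ℝ × ℝ}
    (hx : x ∈ Ioo (-ε) ε ×ˢ Ioo a b) (z : ℝ × ℝ) :
    ContDiffAt ℝ ∞ (fun x => fderiv ℝ γ x z) x :=
  ((h.contDiffAt hx).fderiv_right (m := ∞) (by simp)).clm_apply contDiffAt_const

theorem contDiffAt_form (h : IsCurveFamily A V γ ε a b ℓ) {x : ℝ × ℝ}
    (hx : x ∈ Ioo (-ε) ε ×ˢ Ioo a b) : ContDiffAt ℝ ∞ (fun x => A (γ x)) x :=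
  (h.contactForm.contDiffAt (h.mem x hx)).comp x (h.contDiffAt hx)

theorem contDiffAt_extd (h : IsCurveFamily A V γ ε a b ℓ) {x : ℝ × ℝ}
    (hx : x ∈ Ioo (-ε) ε ×ˢ Ioo a b) : ContDiffAt ℝ ∞ (fun x => extd A (γ x)) x :=
  (h.contactForm.contDiffAt_extd (h.mem x hx)).comp x (h.contDiffAt hx)

/-- The derivative of `A(∂γ)` in the other direction. -/
theorem fderiv_form_apply (h : IsCurveFamily A V γ ε a b ℓ) {x : ℝ × ℝ}
    (hx : x ∈ Ioo (-ε) ε ×ˢ Ioo a b) (z z' : ℝ × ℝ) :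
    fderiv ℝ (fun x => A (γ x) (fderiv ℝ γ x z)) x z' =
      fderiv ℝ A (γ x) (fderiv ℝ γ x z') (fderiv ℝ γ x z) +
        A (γ x) (fderiv ℝ (fderiv ℝ γ) x z' z) := by
  have h1 : HasFDerivAt (fun x => A (γ x)) (fderiv ℝ A (γ x) ∘L fderiv ℝ γ x) x :=
    ((h.contactForm.contDiffAt (h.mem x hx)).differentiableAt (by simp)).hasFDerivAt.comp x
      ((h.contDiffAt hx).differentiableAt (by simp)).hasFDerivAt
  have h2 : HasFDerivAt (fun x => fderiv ℝ γ x z) ((fderiv ℝ (fderiv ℝ γ) x).flip z) x :=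
    (ContinuousLinearMap.apply ℝ E3 z).hasFDerivAt.comp x
      (((h.contDiffAt hx).fderiv_right (m := ∞) (by simp)).differentiableAt (by simp)).hasFDerivAt
  rw [(h1.clm_apply h2).fderiv]
  simp [add_comm]

/-- There is a smooth covector field along the family, prescribing the derivative of a contact
Hamiltonian. -/
theorem exists_multiplier (h : IsCurveFamily A V γ ε a b ℓ) :
    ∃ c : ℝ × ℝ → ℝ, ContDiffOn ℝ ∞ c (Ioo (-ε) ε ×ˢ Ioo a b) ∧
      ∀ x ∈ Ioo (-ε) ε ×ˢ Ioo a b,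
        fderiv ℝ (fun x => A (γ x) (fderiv ℝ γ x (1, 0))) x (0, 1) =
          c x * A (γ x) (fderiv ℝ γ x (0, 1)) -
            extd A (γ x) (fderiv ℝ γ x (1, 0)) (fderiv ℝ γ x (0, 1)) := by
  rcases h.contact with hc | hc
  -- Legendrian case. Since `∂ₛ A(∂ₜγ) - ∂ₜ A(∂ₛγ) = dA(∂ₛγ, ∂ₜγ)` and `A(∂ₛγ)` vanishes
  -- identically, the multiplier 0 works.
  · refine ⟨fun _ => 0, contDiffOn_const, fun x hx => ?_⟩
    have hz : fderiv ℝ (fun x => A (γ x) (fderiv ℝ γ x (0, 1))) x (1, 0) = 0 := by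
      have : (fun x => A (γ x) (fderiv ℝ γ x (0, 1))) =ᶠ[nhds x] fun _ => 0 := by
        filter_upwards [(isOpen_Ioo.prod isOpen_Ioo).mem_nhds hx] with y hy using hc y hy
      rw [this.fderiv_eq]
      simp
    rw [h.fderiv_form_apply hx] at hz ⊢
    have hsymm : fderiv ℝ (fderiv ℝ γ) x (1, 0) (0, 1) = fderiv ℝ (fderiv ℝ γ) x (0, 1) (1, 0) :=
      ((h.contDiffAt hx).isSymmSndFDerivAt (by simpa using two_le_infty)) (1, 0) (0, 1)
    rw [extd_apply]
    rw [hsymm] at hz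
    linarith
  -- Transverse case: the equation is solved for `c` by dividing by `A(∂ₛγ)`.
  · refine ⟨fun x => (fderiv ℝ (fun x => A (γ x) (fderiv ℝ γ x (1, 0))) x (0, 1) +
      extd A (γ x) (fderiv ℝ γ x (1, 0)) (fderiv ℝ γ x (0, 1))) /
        A (γ x) (fderiv ℝ γ x (0, 1)), fun x hx => ?_, fun x hx => ?_⟩
    · refine ContDiffAt.contDiffWithinAt ?_
      have h1 : ContDiffAt ℝ ∞ (fun x => A (γ x) (fderiv ℝ γ x (1, 0))) x :=
        (h.contDiffAt_form hx).clm_apply (h.contDiffAt_fderiv_apply hx _)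
      have h2 : ContDiffAt ℝ ∞ (fun x => A (γ x) (fderiv ℝ γ x (0, 1))) x :=
        (h.contDiffAt_form hx).clm_apply (h.contDiffAt_fderiv_apply hx _)
      have h3 := ((h.contDiffAt_extd hx).clm_apply (h.contDiffAt_fderiv_apply hx (1, 0))).clm_apply
        (h.contDiffAt_fderiv_apply hx (0, 1))
      have h4 : ContDiffAt ℝ ∞
          (fun x => fderiv ℝ (fun x => A (γ x) (fderiv ℝ γ x (1, 0))) x (0, 1)) x :=
        (h1.fderiv_right (m := ∞) (by simp)).clm_apply contDiffAt_const
      exact (h4.add h3).div h2 (hc x hx)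
    · rw [div_mul_cancel₀ _ (hc x hx)]
      ring

/-- A function whose 1-jet along the family is the one of a contact Hamiltonian for the velocity of
the family. -/
theorem exists_jet (h : IsCurveFamily A V γ ε a b ℓ) :
    ∃ (O : Set (ℝ × E3)) (H : ℝ × E3 → ℝ) (c : ℝ × ℝ → ℝ), IsOpen O ∧ ContDiffOn ℝ ∞ H O ∧
      (∀ p, (∃ s ∈ Ioo a b, ℓ (γ (0, s)) = ℓ p) → ((0 : ℝ), p) ∈ O) ∧
      ∀ x ∈ Ioo (-ε) ε ×ˢ Ioo a b, (x.1, γ x) ∈ O ∧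
        H (x.1, γ x) = A (γ x) (fderiv ℝ γ x (1, 0)) ∧
        ∀ v, fderiv ℝ H (x.1, γ x) (0, v) =
          c x * A (γ x) v - extd A (γ x) (fderiv ℝ γ x (1, 0)) v := by
  obtain ⟨c, hc, hcomp⟩ := h.exists_multiplier
  set S := Ioo (-ε) ε ×ˢ Ioo a b with hS
  have hSo : IsOpen S := isOpen_Ioo.prod isOpen_Ioo
  have hlf : ∀ x ∈ S, fderiv ℝ (fun x => ℓ (γ x)) x = ℓ ∘L fderiv ℝ γ x := fun x hx =>
    (ℓ.hasFDerivAt.comp x ((h.contDiffAt hx).differentiableAt (by simp)).hasFDerivAt).fderiv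
  obtain ⟨T, κ, hTo, hκ, hT1, hT2⟩ := exists_smooth_inverse (f := fun x => ℓ (γ x)) (ε := ε)
    (a := a) (b := b) (ℓ.contDiff.comp_contDiffOn h.contDiffOn) (fun x hx => by
      rw [hlf x hx]
      exact h.increasing x hx)
  set β : ℝ × ℝ → E3 →L[ℝ] ℝ := fun x => c x • A (γ x) - extd A (γ x) (fderiv ℝ γ x (1, 0)) with hβ
  set f : ℝ × ℝ → ℝ := fun x => A (γ x) (fderiv ℝ γ x (1, 0)) with hf
  have hfs : ∀ x ∈ S, ContDiffAt ℝ ∞ f x := fun x hx =>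
    (h.contDiffAt_form hx).clm_apply (h.contDiffAt_fderiv_apply hx _)
  have hβs : ∀ x ∈ S, ContDiffAt ℝ ∞ β x := fun x hx =>
    ((hc.contDiffAt (hSo.mem_nhds hx)).smul (h.contDiffAt_form hx)).sub
      ((h.contDiffAt_extd hx).clm_apply (h.contDiffAt_fderiv_apply hx _))
  set j : ℝ × E3 → ℝ × ℝ := fun q => (q.1, ℓ q.2) with hj
  have hjs : ContDiff ℝ ∞ j := contDiff_fst.prodMk (ℓ.contDiff.comp contDiff_snd)
  set O : Set (ℝ × E3) := j ⁻¹' T with hO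
  have hOo : IsOpen O := hTo.preimage hjs.continuous
  set k : ℝ × E3 → ℝ × ℝ := fun q => κ (j q) with hk
  have hks : ∀ q ∈ O, ContDiffAt ℝ ∞ k q := fun q hq =>
    (hκ.contDiffAt (hTo.mem_nhds hq)).comp q hjs.contDiffAt
  -- Here `k (t, p)` is the parameter of the curve point at time `t` on the level of `ℓ` through
  -- `p`, and `H` is the affine function at that point with the wanted value and differential. The
  -- variation of `k` contributes a multiple of `∂ₛf - β(∂ₛγ)`, which is zero by `hcomp`.
  set H : ℝ × E3 → ℝ := fun q => f (k q) + β (k q) (q.2 - γ (k q)) with hH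
  refine ⟨O, H, c, hOo, fun q hq => ContDiffAt.contDiffWithinAt ?_, fun p hp => ?_,
    fun x hx => ?_⟩
  · have hkS := (hT1 _ hq).1
    have e1 : ContDiffAt ℝ ∞ (fun q => f (k q)) q :=
      ContDiffAt.comp q (g := f) (hfs _ hkS) (hks q hq)
    have e2 : ContDiffAt ℝ ∞ (fun q => β (k q)) q := (hβs _ hkS).comp q (hks q hq)
    have e3 : ContDiffAt ℝ ∞ (fun q => γ (k q)) q := (h.contDiffAt hkS).comp q (hks q hq)
    exact e1.add (e2.clm_apply (contDiffAt_snd.sub e3))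
  · obtain ⟨s, hs, hsp⟩ := hp
    have := (hT2 (0, s) ⟨⟨by linarith [h.pos], h.pos⟩, hs⟩).1
    simp only [hsp] at this
    exact this
  · obtain ⟨hxT, hxκ⟩ := hT2 x hx
    set q : ℝ × E3 := (x.1, γ x) with hq
    have hqO : q ∈ O := hxT
    have hkq : k q = x := hxκ
    refine ⟨hqO, ?_, fun v => ?_⟩
    · simp only [hH, hkq]
      simp [hq, hf]
    · have dk : HasFDerivAt k (fderiv ℝ k q) q :=
        ((hks q hqO).differentiableAt (by simp)).hasFDerivAt
      have df : HasFDerivAt f (fderiv ℝ f x) (k q) := by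
        rw [hkq]; exact ((hfs x hx).differentiableAt (by simp)).hasFDerivAt
      have dβ : HasFDerivAt β (fderiv ℝ β x) (k q) := by
        rw [hkq]; exact ((hβs x hx).differentiableAt (by simp)).hasFDerivAt
      have dγ : HasFDerivAt γ (fderiv ℝ γ x) (k q) := by
        rw [hkq]; exact ((h.contDiffAt hx).differentiableAt (by simp)).hasFDerivAt
      have dk1 : (fderiv ℝ k q (0, v)).1 = 0 := by
        have e1 : HasFDerivAt (fun q => (k q).1) (.fst ℝ ℝ ℝ ∘L fderiv ℝ k q) q :=
          hasFDerivAt_fst.comp q dk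
        have e2 : (fun q => (k q).1) =ᶠ[nhds q] Prod.fst := by
          filter_upwards [hOo.mem_nhds hqO] with r hr using (hT1 _ hr).2
        have e3 : HasFDerivAt (Prod.fst : ℝ × E3 → ℝ) (.fst ℝ ℝ E3) q := hasFDerivAt_fst
        exact DFunLike.congr_fun (e1.unique (e3.congr_of_eventuallyEq e2)) ((0 : ℝ), v)
      set m : ℝ := (fderiv ℝ k q (0, v)).2 with hm
      have hkm : fderiv ℝ k q (0, v) = m • ((0 : ℝ), (1 : ℝ)) := by
        ext
        · simp [dk1]
        · simp [hm]
      have d1 : HasFDerivAt (fun q => f (k q)) (fderiv ℝ f x ∘L fderiv ℝ k q) q := df.comp q dk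
      have d2 : HasFDerivAt (fun q => β (k q)) (fderiv ℝ β x ∘L fderiv ℝ k q) q := dβ.comp q dk
      have d3 : HasFDerivAt (fun q => γ (k q)) (fderiv ℝ γ x ∘L fderiv ℝ k q) q := dγ.comp q dk
      have d4 : HasFDerivAt (fun q : ℝ × E3 => q.2 - γ (k q))
          (.snd ℝ ℝ E3 - fderiv ℝ γ x ∘L fderiv ℝ k q) q := hasFDerivAt_snd.sub d3
      have d5 := d1.add (d2.clm_apply d4)
      have e := congrArg (fun L => L ((0 : ℝ), v)) d5.fderiv
      simp only [add_apply, ContinuousLinearMap.comp_apply, ContinuousLinearMap.flip_apply,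
        sub_apply, ContinuousLinearMap.coe_snd', hkq, hkm, map_smul, hcomp x hx] at e
      have hHe : fderiv ℝ H q (0, v) = _ := e
      rw [hHe]
      simp only [hq, sub_self, map_zero, hβ, smul_eq_mul, sub_apply, smul_apply, map_sub, map_smul]
      ring

end IsCurveFamily

end Hamiltonian

/-- Reparametrizing by `σ` turns an evolution defined for `|t| < ε` into one defined for all times
and unchanged near 0. -/
theorem exists_time_cutoff {ε : ℝ} (hε : 0 < ε) : ∃ σ : ℝ → ℝ, ContDiff ℝ ∞ σ ∧
    (∀ t, σ t ∈ Ioo (-ε) ε) ∧ ∃ δ > 0, δ ≤ ε ∧ ∀ t ∈ Ioo (-δ) δ, σ t = t := by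
  set χ : ContDiffBump (0 : ℝ) := ⟨ε / 3, ε / 2, by positivity, by linarith⟩ with hχ
  refine ⟨fun t => t * χ t, contDiff_id.mul χ.contDiff, fun t => ?_, ε / 3, by positivity,
    by linarith, fun t ht => ?_⟩
  · rw [mem_Ioo, ← abs_lt, abs_mul, abs_of_nonneg (χ.nonneg (x := t))]
    by_cases ht : |t| < ε / 2
    · exact (mul_le_of_le_one_right (abs_nonneg t) χ.le_one).trans_lt (by linarith)
    · have : χ t = 0 := χ.zero_of_le_dist (by simpa [hχ] using not_lt.1 ht)
      rw [this, mul_zero]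
      exact hε
  · have : χ t = 1 := χ.one_of_mem_closedBall (by
      simpa [hχ] using (abs_lt.2 ht).le)
    simp [this]

namespace IsCurveFamily

variable {A : E3 → E3 →L[ℝ] ℝ} {V : Set E3} {γ : ℝ × ℝ → E3} {ε a b : ℝ} {ℓ : E3 →L[ℝ] ℝ}

/-- A compactly supported contact Hamiltonian whose contact field extends the velocity of the
family near the centre of a ball. -/
theorem exists_hamiltonian (h : IsCurveFamily A V γ ε a b ℓ) {x₀ : E3} {r : ℝ} (hr : 0 < r)
    (hcov : ∀ p ∈ Metric.closedBall x₀ r, ∃ s ∈ Ioo a b, ℓ (γ (0, s)) = ℓ p) :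
    ∃ H : ℝ × E3 → ℝ, ContDiff ℝ ∞ H ∧ HasCompactSupport H ∧
      (∀ q ∈ tsupport H, q.2 ∈ Metric.closedBall x₀ r) ∧ ∃ δ > 0, δ ≤ ε ∧
      ∀ x ∈ Ioo (-δ) δ ×ˢ Ioo a b,
        γ x ∈ Metric.ball x₀ (r / 2) ∨ fderiv ℝ γ x (1, 0) = 0 →
        (contactField A H (x.1, γ x)).1 = fderiv ℝ γ x (1, 0) := by
  obtain ⟨O, H₀, c, hO, hH₀, hcov', hjet⟩ := h.exists_jet
  have hKO : ({0} : Set ℝ) ×ˢ Metric.closedBall x₀ r ⊆ O := by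
    rintro ⟨t, p⟩ ⟨ht, hp⟩
    obtain rfl : t = 0 := ht
    exact hcov' p (hcov p hp)
  -- The jet extension is known to be defined over the whole closed ball only at time 0; compactness
  -- of the ball extends this to short times.
  obtain ⟨U, W, hU, hW, h0U, hKW, hUW⟩ := generalized_tube_lemma isCompact_singleton
    (isCompact_closedBall x₀ r) hO hKO
  obtain ⟨δ₀, hδ₀, hδU⟩ := Metric.nhds_basis_closedBall.mem_iff.1 (hU.mem_nhds (h0U rfl))
  set δ₁ := min δ₀ ε with hδ₁
  have hδ₁pos : 0 < δ₁ := lt_min hδ₀ h.pos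
  set χ₁ : ContDiffBump (0 : ℝ) := ⟨δ₁ / 2, δ₁, by positivity, by linarith⟩ with hχ₁
  set χ₂ : ContDiffBump x₀ := ⟨r / 2, r, by positivity, by linarith⟩ with hχ₂
  set χ : ℝ × E3 → ℝ := fun q => χ₁ q.1 * χ₂ q.2 with hχ
  have hχs : ContDiff ℝ ∞ χ :=
    (χ₁.contDiff.comp contDiff_fst).mul (χ₂.contDiff.comp contDiff_snd)
  set B : Set (ℝ × E3) := Metric.closedBall (0 : ℝ) δ₁ ×ˢ Metric.closedBall x₀ r with hB
  have hBc : IsCompact B := (isCompact_closedBall _ _).prod (isCompact_closedBall _ _)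
  have hχB : tsupport χ ⊆ B := by
    refine closure_minimal (fun q hq => ?_) hBc.isClosed
    have hq' : χ₁ q.1 ≠ 0 ∧ χ₂ q.2 ≠ 0 := mul_ne_zero_iff.1 hq
    refine ⟨Metric.ball_subset_closedBall ?_, Metric.ball_subset_closedBall ?_⟩
    · have := χ₁.support_eq ▸ (Function.mem_support.2 hq'.1)
      exact this
    · have := χ₂.support_eq ▸ (Function.mem_support.2 hq'.2)
      exact this
  have hBO : B ⊆ O := fun q hq => hUW
    ⟨hδU (Metric.closedBall_subset_closedBall (min_le_left _ _) hq.1), hKW hq.2⟩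
  have hts : tsupport (fun q => χ q * H₀ q) ⊆ B := (tsupport_mul_subset_left).trans hχB
  refine ⟨fun q => χ q * H₀ q, ?_, hBc.of_isClosed_subset (isClosed_tsupport _) hts,
    fun q hq => (hts hq).2, δ₁ / 2, by positivity, ?_, fun x hx hx' => ?_⟩
  · rw [contDiff_iff_contDiffAt]
    intro q
    by_cases hq : q ∈ tsupport fun q => χ q * H₀ q
    · exact hχs.contDiffAt.mul (hH₀.contDiffAt (hO.mem_nhds (hBO (hts hq))))
    · exact contDiffAt_const.congr_of_eventuallyEq (notMem_tsupport_iff_eventuallyEq.1 hq)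
  · have : δ₁ ≤ ε := min_le_right _ _
    linarith
  · have hδε : δ₁ ≤ ε := min_le_right _ _
    have hxS : x ∈ Ioo (-ε) ε ×ˢ Ioo a b :=
      ⟨⟨by linarith [hx.1.1], by linarith [hx.1.2]⟩, hx.2⟩
    obtain ⟨hqO, hval, hder⟩ := hjet x hxS
    set q : ℝ × E3 := (x.1, γ x) with hq
    have dH : HasFDerivAt H₀ (fderiv ℝ H₀ q) q :=
      ((hH₀.contDiffAt (hO.mem_nhds hqO)).differentiableAt (by simp)).hasFDerivAt
    have dχ : HasFDerivAt χ (fderiv ℝ χ q) q := (hχs.differentiable (by simp) q).hasFDerivAt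
    rcases hx' with hx' | hx'
    · have hχ1 : χ =ᶠ[nhds q] fun _ => 1 := by
        have ho : IsOpen (Ioo (-(δ₁ / 2)) (δ₁ / 2) ×ˢ Metric.ball x₀ (r / 2)) :=
          isOpen_Ioo.prod Metric.isOpen_ball
        filter_upwards [ho.mem_nhds (show q ∈ _ from ⟨hx.1, hx'⟩)] with y hy
        have e1 : χ₁ y.1 = 1 := χ₁.one_of_mem_closedBall (by
          simpa [hχ₁] using (abs_lt.2 hy.1).le)
        have e2 : χ₂ y.2 = 1 := χ₂.one_of_mem_closedBall (Metric.ball_subset_closedBall hy.2)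
        simp [hχ, e1, e2]
      have hHH : (fun q => χ q * H₀ q) =ᶠ[nhds q] H₀ := by
        filter_upwards [hχ1] with y hy
        rw [hy, one_mul]
      refine h.contactForm.contactField_eq _ (q := q) (g := c x) (h.mem x hxS) ?_ fun v => ?_
      · rw [hHH.eq_of_nhds, hval]
      · rw [hHH.fderiv_eq, hder]
    -- Where the velocity vanishes, `H₀` has value 0 and differential `c A`, so `χ H₀` has
    -- differential `χ c A` and its contact field is still 0. Hence the cutoff does not disturb
    -- stationary points, even where `χ` is not locally constant.
    · refine h.contactForm.contactField_eq _ (q := q) (g := χ q * c x) (h.mem x hxS) ?_ fun v => ?_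
      · rw [hval]
        simp only [hx', map_zero, mul_zero]
      · have e : HasFDerivAt (fun q => χ q * H₀ q)
            (χ q • fderiv ℝ H₀ q + H₀ q • fderiv ℝ χ q) q := dχ.mul dH
        rw [e.fderiv]
        simp only [add_apply, smul_apply, smul_eq_mul, hder, hval, hx', map_zero, zero_apply,
          sub_zero, zero_mul, add_zero]
        ring

end IsCurveFamily

/-! ### Local contact isotopies. -/

/-- `F t` is a smooth isotopy of `ℝ³`, supported in `K`, with inverses `G t`, which preserves the
kernel of `A` over `V`. -/
structure IsLocalContactIsotopy (A : E3 → E3 →L[ℝ] ℝ) (V K : Set E3) (F G : ℝ × E3 → E3) :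
    Prop where
  contDiff : ContDiff ℝ ∞ F
  contDiff_inv : ContDiff ℝ ∞ G
  zero : ∀ x, F (0, x) = x
  left_inv : ∀ t x, G (t, F (t, x)) = x
  right_inv : ∀ t x, F (t, G (t, x)) = x
  eq_self : ∀ t, ∀ x ∉ K, F (t, x) = x
  contact : ∀ t, ∀ x ∈ V, ∀ v, A (F (t, x)) (fderiv ℝ F (t, x) (0, v)) = 0 ↔ A x v = 0

/-- The flow of a contact Hamiltonian, as a contact isotopy. -/
theorem exists_isLocalContactIsotopy {A : E3 → E3 →L[ℝ] ℝ} {V K : Set E3}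
    (hA : IsContactForm A V) (hK : IsClosed K) (hKV : K ⊆ V) {H : ℝ × E3 → ℝ}
    (hH : ContDiff ℝ ∞ H) (hHc : HasCompactSupport H) (hHK : ∀ q ∈ tsupport H, q.2 ∈ K) :
    ∃ F G, IsLocalContactIsotopy A V K F G ∧ ∃ δ > 0, ∀ δ' > 0, δ' ≤ δ → ∀ γ : ℝ → E3,
      (∀ t ∈ Ioo (-δ') δ', HasDerivAt γ (contactField A H (t, γ t)).1 t) →
      ∀ t ∈ Ioo (-δ') δ', F (t, γ 0) = γ t := by
  have hHV : ∀ q ∈ tsupport H, q.2 ∈ V := fun q hq => hKV (hHK q hq)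
  have hC := hA.contDiff_contactField hH hHV
  have hCc : HasCompactSupport (contactField A H) :=
    hHc.isCompact.of_isClosed_subset (isClosed_tsupport _)
      (IsContactForm.tsupport_contactField_subset A H)
  set X : ℝ × E3 → E3 := fun q => (contactField A H q).1 with hX
  have hXs : ContDiff ℝ ∞ X := hC.fst
  have hXc : HasCompactSupport X := hCc.comp_left (g := Prod.fst) rfl
  have hXK : ∀ t, ∀ x ∉ K, X (t, x) = 0 := fun t x hx => by
    rw [hX]
    simp only
    rw [IsContactForm.contactField_eq_zero A fun h => hx (hHK _ h)]
    rfl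
  obtain ⟨L, hL⟩ := ContDiff.lipschitzWith_of_hasCompactSupport hXc hXs (by simp)
  obtain ⟨C, hCb⟩ := hCc.exists_bound_of_continuous hC.continuous
  have hgb : ∀ q, ‖(contactField A H q).2‖ ≤ C.toNNReal := fun q =>
    (norm_snd_le _).trans ((hCb q).trans (Real.le_coe_toNNReal C))
  obtain ⟨ε, F, G, hF⟩ := exists_isEvolution hXs hXc
  obtain ⟨σ, hσ, hσε, δ, hδ, hδε, hσδ⟩ := exists_time_cutoff hF.pos
  have hself : ∀ t ∈ Ioo (-ε) ε, ∀ x ∉ K, F (t, x) = x := fun t ht x hx =>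
    hF.eq_self hL hF.pos le_rfl (fun t _ => hXK t x hx) ht
  -- A point outside `K` is fixed, so by injectivity no point of `K` can arrive there.
  have hmemK : ∀ t ∈ Ioo (-ε) ε, ∀ x ∈ K, F (t, x) ∈ K := fun t ht x hx => by
    by_contra hn
    have h1 := hself t ht _ hn
    have h2 := congrArg (fun y => G (t, y)) h1
    simp only [hF.left_inv t ht] at h2
    exact hn (by rwa [h2])
  refine ⟨fun q => F (σ q.1, q.2), fun q => G (σ q.1, q.2), ⟨?_, ?_, fun x => ?_, fun t x => ?_,
    fun t x => ?_, fun t x hx => ?_, fun t x hx v => ?_⟩, δ, hδ, fun δ' hδ' hδδ γ hγ t ht => ?_⟩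
  · rw [contDiff_iff_contDiffAt]
    intro q
    exact ContDiffAt.comp q (g := F) (f := fun q : ℝ × E3 => (σ q.1, q.2))
      (hF.contDiffAt _ (hσε q.1) q.2) ((hσ.comp contDiff_fst).prodMk contDiff_snd).contDiffAt
  · rw [contDiff_iff_contDiffAt]
    intro q
    exact ContDiffAt.comp q (g := G) (f := fun q : ℝ × E3 => (σ q.1, q.2))
      (hF.contDiffAt_inv _ (hσε q.1) q.2) ((hσ.comp contDiff_fst).prodMk contDiff_snd).contDiffAt
  · simp only
    rw [hσδ 0 ⟨by linarith, hδ⟩, hF.zero]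
  · exact hF.left_inv _ (hσε t) x
  · exact hF.right_inv _ (hσε t) x
  · exact hself _ (hσε t) x hx
  · have hd : fderiv ℝ (fun q : ℝ × E3 => F (σ q.1, q.2)) (t, x) (0, v) =
        fderiv ℝ F (σ t, x) (0, v) := by
      have e1 : HasFDerivAt (fun q : ℝ × E3 => (σ q.1, q.2))
          ((fderiv ℝ σ t ∘L .fst ℝ ℝ E3).prod (.snd ℝ ℝ E3)) (t, x) :=
        HasFDerivAt.prodMk (HasFDerivAt.comp (g := σ) (t, x)
          (hσ.differentiable (by simp) t).hasFDerivAt hasFDerivAt_fst) hasFDerivAt_snd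
      have e2 := HasFDerivAt.comp (g := F) (t, x) (hF.hasFDerivAt (hσε t) x) e1
      have e3 := DFunLike.congr_fun e2.fderiv ((0 : ℝ), v)
      refine e3.trans ?_
      simp
    rw [hd]
    -- Trajectories from `K` stay in `K ⊆ V`, where the Lie derivative identity is available; near a
    -- point outside `K` the map is the identity.
    by_cases hxK : x ∈ K
    · exact hF.apply_fderiv_eq_zero_iff (hXs.differentiable (by simp)) hA.isOpen hA.contDiffOn
        (g := fun q => (contactField A H q).2) hgb
        (fun t p hp v => hA.lie_contactField hH hHV t hp v)
        (fun t ht => hKV (hmemK t ht x hxK)) (hσε t) v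
    · have e1 : (fun z => F (σ t, z)) =ᶠ[nhds x] id := by
        filter_upwards [hK.isOpen_compl.mem_nhds hxK] with z hz using hself _ (hσε t) z hz
      have e2 : HasFDerivAt (fun z => F (σ t, z)) (fderiv ℝ F (σ t, x) ∘L .inr ℝ ℝ E3) x :=
        (hF.hasFDerivAt (hσε t) x).comp x (hasFDerivAt_prodMk_right _ x)
      have e3 := DFunLike.congr_fun (e2.unique ((hasFDerivAt_id x).congr_of_eventuallyEq e1)) v
      have e4 : fderiv ℝ F (σ t, x) (0, v) = v := e3
      simp only
      rw [e4, hself _ (hσε t) x hxK]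
  · simp only
    rw [hσδ t ⟨by linarith [ht.1], by linarith [ht.2]⟩]
    exact hF.eq_of_hasDerivAt hL hδ' (hδδ.trans hδε) hγ ht

/-- A family of Legendrian or transverse curves is followed by a contact isotopy supported in a
ball. -/
theorem IsCurveFamily.exists_isLocalContactIsotopy {A : E3 → E3 →L[ℝ] ℝ} {V : Set E3}
    {γ : ℝ × ℝ → E3} {ε a b : ℝ} {ℓ : E3 →L[ℝ] ℝ} (h : IsCurveFamily A V γ ε a b ℓ) {x₀ : E3}
    {r : ℝ} (hr : 0 < r)
    (hcov : ∀ p ∈ Metric.closedBall x₀ r, ∃ s ∈ Ioo a b, ℓ (γ (0, s)) = ℓ p)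
    (hV : Metric.closedBall x₀ r ⊆ V) :
    ∃ F G, IsLocalContactIsotopy A V (Metric.closedBall x₀ r) F G ∧ ∃ δ > 0, δ ≤ ε ∧
      ∀ δ' > 0, δ' ≤ δ → ∀ s ∈ Ioo a b,
        (∀ t ∈ Ioo (-δ') δ', γ (t, s) ∈ Metric.ball x₀ (r / 2)) ∨
          (∀ t ∈ Ioo (-δ') δ', γ (t, s) = γ (0, s)) →
        ∀ t ∈ Ioo (-δ') δ', F (t, γ (0, s)) = γ (t, s) := by
  obtain ⟨H, hH, hHc, hHK, δ₁, hδ₁, hδ₁ε, hfield⟩ := h.exists_hamiltonian hr hcov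
  obtain ⟨F, G, hFG, δ₂, hδ₂, hflow⟩ := ContactKnots.exists_isLocalContactIsotopy h.contactForm
    Metric.isClosed_closedBall hV hH hHc hHK
  refine ⟨F, G, hFG, min δ₁ δ₂, lt_min hδ₁ hδ₂, (min_le_left _ _).trans hδ₁ε,
    fun δ' hδ' hδδ s hs hcase t ht => ?_⟩
  refine hflow δ' hδ' (hδδ.trans (min_le_right _ _)) (fun t => γ (t, s)) (fun t ht => ?_) t ht
  have hδδ₁ : δ' ≤ δ₁ := hδδ.trans (min_le_left _ _)
  have hx : (t, s) ∈ Ioo (-δ₁) δ₁ ×ˢ Ioo a b :=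
    ⟨⟨by linarith [ht.1], by linarith [ht.2]⟩, hs⟩
  have hxε : (t, s) ∈ Ioo (-ε) ε ×ˢ Ioo a b :=
    ⟨⟨by linarith [ht.1], by linarith [ht.2]⟩, hs⟩
  have hd : HasDerivAt (fun t => γ (t, s)) (fderiv ℝ γ (t, s) (1, 0)) t :=
    ((h.contDiffAt hxε).differentiableAt (by simp)).hasFDerivAt.comp_hasDerivAt t
      ((hasDerivAt_id t).prodMk (hasDerivAt_const t s))
  rw [hfield (t, s) hx ?_]
  · exact hd
  · rcases hcase with hc | hc
    · exact Or.inl (hc t ht)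
    · right
      have e : (fun t => γ (t, s)) =ᶠ[nhds t] fun _ => γ (0, s) := by
        filter_upwards [isOpen_Ioo.mem_nhds ht] with t' ht' using hc t' ht'
      exact hd.unique ((hasDerivAt_const t (γ (0, s))).congr_of_eventuallyEq e)

/-! ### Contact isotopies with explicit inverses. -/

section ContactIsotopyPair

variable {M : Type*} [TopologicalSpace M] [ChartedSpace E3 M]

/-- The vector `v`, seen as a tangent vector at `x`, lies in the plane `ξ x`. -/
def InPlane (ξ : ∀ x : M, Submodule ℝ (TangentSpace (𝓡 3) x)) (x : M) (v : E3) : Prop :=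
  (show TangentSpace (𝓡 3) x from v) ∈ ξ x

/-- `Φ` is a smooth family of contactomorphisms, starting at the identity, with smooth family of
inverses `Ψ`. -/
structure IsContactIsotopyPair (ξ : ∀ x : M, Submodule ℝ (TangentSpace (𝓡 3) x))
    (Φ Ψ : ℝ → M → M) : Prop where
  smooth : ContMDiff (𝓘(ℝ, ℝ).prod (𝓡 3)) (𝓡 3) ∞ fun q : ℝ × M => Φ q.1 q.2
  smooth_inv : ContMDiff (𝓘(ℝ, ℝ).prod (𝓡 3)) (𝓡 3) ∞ fun q : ℝ × M => Ψ q.1 q.2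
  zero : ∀ x, Φ 0 x = x
  left_inv : ∀ t x, Ψ t (Φ t x) = x
  right_inv : ∀ t x, Φ t (Ψ t x) = x
  contact : ∀ t x (v : E3), InPlane ξ (Φ t x) (mfderiv (𝓡 3) (𝓡 3) (Φ t) x v) ↔ InPlane ξ x v

namespace IsContactIsotopyPair

variable {ξ : ∀ x : M, Submodule ℝ (TangentSpace (𝓡 3) x)} {Φ Ψ Φ' Ψ' : ℝ → M → M}

theorem contMDiff_slice (h : IsContactIsotopyPair ξ Φ Ψ) (t : ℝ) :
    ContMDiff (𝓡 3) (𝓡 3) ∞ (Φ t) :=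
  h.smooth.comp (contMDiff_const.prodMk contMDiff_id : ContMDiff (𝓡 3) (𝓘(ℝ, ℝ).prod (𝓡 3)) ∞
    fun x : M => (t, x))

theorem contMDiff_slice_inv (h : IsContactIsotopyPair ξ Φ Ψ) (t : ℝ) :
    ContMDiff (𝓡 3) (𝓡 3) ∞ (Ψ t) :=
  h.smooth_inv.comp (contMDiff_const.prodMk contMDiff_id :
    ContMDiff (𝓡 3) (𝓘(ℝ, ℝ).prod (𝓡 3)) ∞ fun x : M => (t, x))

theorem mdifferentiableAt (h : IsContactIsotopyPair ξ Φ Ψ) (t : ℝ) (x : M) :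
    MDifferentiableAt (𝓡 3) (𝓡 3) (Φ t) x :=
  (h.contMDiff_slice t).mdifferentiableAt (by simp)

theorem mdifferentiableAt_inv (h : IsContactIsotopyPair ξ Φ Ψ) (t : ℝ) (x : M) :
    MDifferentiableAt (𝓡 3) (𝓡 3) (Ψ t) x :=
  (h.contMDiff_slice_inv t).mdifferentiableAt (by simp)

theorem refl (ξ : ∀ x : M, Submodule ℝ (TangentSpace (𝓡 3) x)) :
    IsContactIsotopyPair ξ (fun _ x => x) (fun _ x => x) where
  smooth := contMDiff_snd
  smooth_inv := contMDiff_snd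
  zero _ := rfl
  left_inv _ _ := rfl
  right_inv _ _ := rfl
  contact t x v := by
    have : mfderiv (𝓡 3) (𝓡 3) (fun x : M => x) x = ContinuousLinearMap.id ℝ _ := mfderiv_id
    rw [this]
    rfl

theorem mfderiv_comp_apply (h : IsContactIsotopyPair ξ Φ Ψ) (h' : IsContactIsotopyPair ξ Φ' Ψ')
    (t : ℝ) (x : M) (v : E3) : mfderiv (𝓡 3) (𝓡 3) (fun x => Φ t (Φ' t x)) x v =
      mfderiv (𝓡 3) (𝓡 3) (Φ t) (Φ' t x) (mfderiv (𝓡 3) (𝓡 3) (Φ' t) x v) :=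
  DFunLike.congr_fun (mfderiv_comp x (h.mdifferentiableAt t (Φ' t x)) (h'.mdifferentiableAt t x)) v

theorem comp (h : IsContactIsotopyPair ξ Φ Ψ) (h' : IsContactIsotopyPair ξ Φ' Ψ') :
    IsContactIsotopyPair ξ (fun t x => Φ t (Φ' t x)) (fun t x => Ψ' t (Ψ t x)) where
  smooth := h.smooth.comp (contMDiff_fst.prodMk h'.smooth)
  smooth_inv := h'.smooth_inv.comp (contMDiff_fst.prodMk h.smooth_inv)
  zero x := by rw [h'.zero, h.zero]
  left_inv t x := by rw [h.left_inv, h'.left_inv]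
  right_inv t x := by rw [h'.right_inv, h.right_inv]
  contact t x v := by
    rw [h.mfderiv_comp_apply h']
    exact (h.contact t _ _).trans (h'.contact t x v)

theorem symm (h : IsContactIsotopyPair ξ Φ Ψ) : IsContactIsotopyPair ξ Ψ Φ where
  smooth := h.smooth_inv
  smooth_inv := h.smooth
  zero x := by
    have := h.left_inv 0 x
    rwa [h.zero] at this
  left_inv := h.right_inv
  right_inv := h.left_inv
  contact t x v := by
    have h1 : mfderiv (𝓡 3) (𝓡 3) (Φ t) (Ψ t x) (mfderiv (𝓡 3) (𝓡 3) (Ψ t) x v) = v := by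
      have e1 := mfderiv_comp x (h.mdifferentiableAt t (Ψ t x)) (h.mdifferentiableAt_inv t x)
      have e2 : Φ t ∘ Ψ t = id := funext (h.right_inv t)
      rw [e2, mfderiv_id] at e1
      exact (DFunLike.congr_fun e1 v).symm
    have h2 := h.contact t (Ψ t x) (mfderiv (𝓡 3) (𝓡 3) (Ψ t) x v)
    rw [h1, h.right_inv] at h2
    exact h2.symm

theorem rescale (h : IsContactIsotopyPair ξ Φ Ψ) (c : ℝ) :
    IsContactIsotopyPair ξ (fun t => Φ (c * t)) (fun t => Ψ (c * t)) where
  smooth := h.smooth.comp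
    (((contDiff_const.mul contDiff_id).contMDiff.comp contMDiff_fst).prodMk contMDiff_snd :
      ContMDiff (𝓘(ℝ, ℝ).prod (𝓡 3)) (𝓘(ℝ, ℝ).prod (𝓡 3)) ∞ fun q : ℝ × M => (c * q.1, q.2))
  smooth_inv := h.smooth_inv.comp
    (((contDiff_const.mul contDiff_id).contMDiff.comp contMDiff_fst).prodMk contMDiff_snd :
      ContMDiff (𝓘(ℝ, ℝ).prod (𝓡 3)) (𝓘(ℝ, ℝ).prod (𝓡 3)) ∞ fun q : ℝ × M => (c * q.1, q.2))
  zero x := by simp only [mul_zero, h.zero]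
  left_inv t := h.left_inv _
  right_inv t := h.right_inv _
  contact t := h.contact _

/-- The diffeomorphism at time `t`. -/
def toDiffeomorph (h : IsContactIsotopyPair ξ Φ Ψ) (t : ℝ) : M ≃ₘ⟮𝓡 3, 𝓡 3⟯ M where
  toFun := Φ t
  invFun := Ψ t
  left_inv := h.left_inv t
  right_inv := h.right_inv t
  contMDiff_toFun := h.contMDiff_slice t
  contMDiff_invFun := h.contMDiff_slice_inv t

theorem isContactIsotopy (h : IsContactIsotopyPair ξ Φ Ψ) :
    IsContactIsotopy ξ h.toDiffeomorph := by
  refine ⟨h.smooth.contMDiffOn, fun t _ x => ?_, h.zero⟩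
  have hs : Function.Surjective (mfderiv (𝓡 3) (𝓡 3) (h.toDiffeomorph t) x) :=
    ((h.toDiffeomorph t).mfderivToContinuousLinearEquiv (by simp) x).surjective
  ext w
  rw [Submodule.mem_map]
  constructor
  · rintro ⟨v, hv, rfl⟩
    exact (h.contact t x v).2 hv
  · intro hw
    obtain ⟨v, rfl⟩ := hs w
    exact ⟨v, (h.contact t x v).1 hw, rfl⟩

end IsContactIsotopyPair

end ContactIsotopyPair

/-! ### From a chart to the manifold. -/

section Transplant

namespace IsLocalContactIsotopy

variable {A : E3 → E3 →L[ℝ] ℝ} {V K : Set E3} {F G : ℝ × E3 → E3}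

theorem mapsTo (h : IsLocalContactIsotopy A V K F G) (t : ℝ) {x : E3} (hx : x ∈ K) :
    F (t, x) ∈ K := by
  by_contra hn
  have h2 := congrArg (fun y => G (t, y)) (h.eq_self t _ hn)
  simp only [h.left_inv] at h2
  exact hn (by rwa [h2])

theorem mapsTo_superset (h : IsLocalContactIsotopy A V K F G) {W : Set E3} (hW : K ⊆ W) (t : ℝ)
    {x : E3} (hx : x ∈ W) : F (t, x) ∈ W := by
  by_cases hK : x ∈ K
  · exact hW (h.mapsTo t hK)
  · rwa [h.eq_self t x hK]

theorem inv_eq_self (h : IsLocalContactIsotopy A V K F G) (t : ℝ) {x : E3} (hx : x ∉ K) :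
    G (t, x) = x := by
  conv_lhs => rw [← h.eq_self t x hx]
  exact h.left_inv t x

theorem inv_mapsTo_superset (h : IsLocalContactIsotopy A V K F G) {W : Set E3} (hW : K ⊆ W) (t : ℝ)
    {x : E3} (hx : x ∈ W) : G (t, x) ∈ W := by
  by_cases hK : x ∈ K
  · refine hW ?_
    by_contra hn
    have := h.eq_self t _ hn
    rw [h.right_inv] at this
    exact hn (this ▸ hK)
  · rwa [h.inv_eq_self t hK]

end IsLocalContactIsotopy

variable {M : Type*} [TopologicalSpace M]

open Classical in
/-- A family of maps of `ℝ³`, transplanted to a manifold by a chart. -/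
noncomputable def transplant (e : OpenPartialHomeomorph M E3) (F : ℝ × E3 → E3) (t : ℝ) (x : M) :
    M :=
  if x ∈ e.source then e.symm (F (t, e x)) else x

theorem transplant_of_mem {e : OpenPartialHomeomorph M E3} (F : ℝ × E3 → E3) (t : ℝ) {x : M}
    (hx : x ∈ e.source) : transplant e F t x = e.symm (F (t, e x)) := if_pos hx

theorem transplant_eq_self {e : OpenPartialHomeomorph M E3} {F : ℝ × E3 → E3} {K : Set E3}
    (hF : ∀ t, ∀ x ∉ K, F (t, x) = x) (t : ℝ) {x : M} (hx : x ∉ e.symm '' K) :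
    transplant e F t x = x := by
  by_cases hxe : x ∈ e.source
  · rw [transplant_of_mem F t hxe, hF t (e x) fun h => hx ⟨e x, h, e.left_inv hxe⟩,
      e.left_inv hxe]
  · exact if_neg hxe

theorem transplant_transplant {e : OpenPartialHomeomorph M E3} {F G : ℝ × E3 → E3} {t : ℝ}
    (hFe : ∀ x ∈ e.target, F (t, x) ∈ e.target) (hGF : ∀ x, G (t, F (t, x)) = x) (x : M) :
    transplant e G t (transplant e F t x) = x := by
  by_cases hx : x ∈ e.source
  · have h1 := hFe _ (e.map_source hx)
    rw [transplant_of_mem F t hx, transplant_of_mem G t (e.map_target h1), e.right_inv h1, hGF,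
      e.left_inv hx]
  · have h1 : transplant e F t x = x := if_neg hx
    rw [h1]
    exact if_neg hx

variable [ChartedSpace E3 M]

/-- Over `e.source` this is a composition of smooth maps. The image of the compact set `K` is closed
because `M` is Hausdorff, so near any point outside `e.source` the map is the identity. -/
theorem contMDiff_transplant [T2Space M] [IsManifold (𝓡 3) ∞ M] {e : OpenPartialHomeomorph M E3}
    (he : e ∈ IsManifold.maximalAtlas (𝓡 3) ∞ M)
    {F : ℝ × E3 → E3} (hFs : ContDiff ℝ ∞ F) {K : Set E3} (hKc : IsCompact K)
    (hF : ∀ t, ∀ x ∉ K, F (t, x) = x) (hFe : ∀ t, ∀ x ∈ e.target, F (t, x) ∈ e.target)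
    (hK : K ⊆ e.target) :
    ContMDiff (𝓘(ℝ, ℝ).prod (𝓡 3)) (𝓡 3) ∞ fun q : ℝ × M => transplant e F q.1 q.2 := by
  rintro ⟨t, x⟩
  by_cases hx : x ∈ e.source
  · have h1 : ContMDiffAt (𝓘(ℝ, ℝ).prod (𝓡 3)) 𝓘(ℝ, ℝ × E3) ∞
        (fun q : ℝ × M => (q.1, e q.2)) (t, x) := by
      have e1 : ContMDiffAt (𝓘(ℝ, ℝ).prod (𝓡 3)) (𝓡 3) ∞ (fun q : ℝ × M => e q.2) (t, x) :=
        ContMDiffAt.comp (t, x) (contMDiffAt_of_mem_maximalAtlas he hx) contMDiffAt_snd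
      exact contMDiffAt_fst.prodMk_space e1
    have h2 : ContMDiffAt (𝓘(ℝ, ℝ).prod (𝓡 3)) (𝓡 3) ∞
        (fun q : ℝ × M => F (q.1, e q.2)) (t, x) :=
      ContMDiffAt.comp (t, x) (g := F) hFs.contMDiff.contMDiffAt h1
    have h3 : ContMDiffAt (𝓘(ℝ, ℝ).prod (𝓡 3)) (𝓡 3) ∞
        (fun q : ℝ × M => e.symm (F (q.1, e q.2))) (t, x) :=
      ContMDiffAt.comp (t, x) (g := e.symm)
        (contMDiffAt_symm_of_mem_maximalAtlas he (hFe t _ (e.map_source hx))) h2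
    refine h3.congr_of_eventuallyEq ?_
    filter_upwards [(e.open_source.preimage continuous_snd).mem_nhds
      (show (t, x) ∈ Prod.snd ⁻¹' e.source from hx)] with q hq using transplant_of_mem F q.1 hq
  · have hc : IsClosed (e.symm '' K) :=
      (hKc.image_of_continuousOn (e.continuousOn_symm.mono hK)).isClosed
    have hxc : x ∉ e.symm '' K := by
      rintro ⟨y, hy, rfl⟩
      exact hx (e.map_target (hK hy))
    refine (contMDiffAt_snd (I := 𝓘(ℝ, ℝ)) (J := 𝓡 3)).congr_of_eventuallyEq ?_
    filter_upwards [(hc.isOpen_compl.preimage continuous_snd).mem_nhds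
      (show (t, x) ∈ Prod.snd ⁻¹' (e.symm '' K)ᶜ from hxc)] with q hq
      using transplant_eq_self hF q.1 hq

theorem IsLocalContactIsotopy.isContactIsotopyPair [T2Space M] [IsManifold (𝓡 3) ∞ M]
    {ξ : ∀ x : M, Submodule ℝ (TangentSpace (𝓡 3) x)} {A : E3 → E3 →L[ℝ] ℝ} {V K : Set E3}
    {F G : ℝ × E3 → E3} (h : IsLocalContactIsotopy A V K F G) {e : OpenPartialHomeomorph M E3}
    (he : e ∈ IsManifold.maximalAtlas (𝓡 3) ∞ M) (hKc : IsCompact K) (hKV : K ⊆ V)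
    (hVe : V ⊆ e.target)
    (hξ : ∀ x ∈ e.source, e x ∈ V → ∀ v : E3,
      InPlane ξ x v ↔ A (e x) (mfderiv (𝓡 3) (𝓡 3) e x v) = 0) :
    IsContactIsotopyPair ξ (transplant e F) (transplant e G) := by
  have hKe := hKV.trans hVe
  have hFe : ∀ t, ∀ x ∈ e.target, F (t, x) ∈ e.target := fun t x hx => h.mapsTo_superset hKe t hx
  have hGe : ∀ t, ∀ x ∈ e.target, G (t, x) ∈ e.target := fun t x hx =>
    h.inv_mapsTo_superset hKe t hx
  have hsm := contMDiff_transplant he h.contDiff hKc h.eq_self hFe hKe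
  refine ⟨hsm, contMDiff_transplant he h.contDiff_inv hKc (fun t x hx => h.inv_eq_self t hx) hGe hKe,
    fun x => ?_, fun t x => transplant_transplant (hFe t) (h.left_inv t) x,
    fun t x => transplant_transplant (hGe t) (h.right_inv t) x, fun t x v => ?_⟩
  · by_cases hx : x ∈ e.source
    · rw [transplant_of_mem F 0 hx, h.zero, e.left_inv hx]
    · exact if_neg hx
  · by_cases hx : x ∈ e.source ∧ e x ∈ V
    · obtain ⟨hxe, hxV⟩ := hx
      have hFV := h.mapsTo_superset hKV t hxV
      have hΦ : transplant e F t x = e.symm (F (t, e x)) := transplant_of_mem F t hxe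
      have hΦe : transplant e F t x ∈ e.source := hΦ ▸ e.map_target (hVe hFV)
      have heΦ : e (transplant e F t x) = F (t, e x) := by rw [hΦ, e.right_inv (hVe hFV)]
      have hed : ∀ y ∈ e.source, MDifferentiableAt (𝓡 3) (𝓡 3) e y := fun y hy =>
        (contMDiffAt_of_mem_maximalAtlas he hy).mdifferentiableAt (by simp)
      have hsl : MDifferentiableAt (𝓡 3) (𝓡 3) (transplant e F t) x :=
        (hsm.comp (contMDiff_const.prodMk contMDiff_id :
          ContMDiff (𝓡 3) (𝓘(ℝ, ℝ).prod (𝓡 3)) ∞ fun x : M => (t, x))).mdifferentiableAt (by simp)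
      have hFd : HasFDerivAt (fun z => F (t, z)) (fderiv ℝ F (t, e x) ∘L .inr ℝ ℝ E3) (e x) :=
        ((h.contDiff.differentiable (by simp)) _).hasFDerivAt.comp _ (hasFDerivAt_prodMk_right t _)
      have c1 : HasMFDerivAt (𝓡 3) (𝓡 3) (fun y => e (transplant e F t y)) x
          ((mfderiv (𝓡 3) (𝓡 3) e (transplant e F t x)).comp
            (mfderiv (𝓡 3) (𝓡 3) (transplant e F t) x)) :=
        HasMFDerivAt.comp x (hed _ hΦe).hasMFDerivAt hsl.hasMFDerivAt
      have c2 : HasMFDerivAt (𝓡 3) (𝓡 3) (fun y => F (t, e y)) x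
          ((fderiv ℝ F (t, e x) ∘L .inr ℝ ℝ E3).comp (mfderiv (𝓡 3) (𝓡 3) e x)) :=
        HasMFDerivAt.comp x (g := fun z => F (t, z)) (f := e) hFd.hasMFDerivAt (hed _ hxe).hasMFDerivAt
      have c3 : (fun y => e (transplant e F t y)) =ᶠ[nhds x] fun y => F (t, e y) := by
        filter_upwards [e.open_source.mem_nhds hxe] with y hy
        rw [transplant_of_mem F t hy, e.right_inv (hFe t _ (e.map_source hy))]
      have c4 : mfderiv (𝓡 3) (𝓡 3) e (transplant e F t x)
          (mfderiv (𝓡 3) (𝓡 3) (transplant e F t) x v) =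
          fderiv ℝ F (t, e x) (0, mfderiv (𝓡 3) (𝓡 3) e x v) :=
        DFunLike.congr_fun (hasMFDerivAt_unique c1 (c2.congr_of_eventuallyEq c3)) v
      exact (hξ _ hΦe (heΦ ▸ hFV) _).trans
        ((iff_of_eq (congrArg₂ (fun p w => A p w = 0) heΦ c4)).trans
          ((h.contact t _ hxV _).trans (hξ x hxe hxV v).symm))
    · have hc : IsClosed (e.symm '' K) :=
        (hKc.image_of_continuousOn (e.continuousOn_symm.mono hKe)).isClosed
      have hxc : x ∉ e.symm '' K := by
        rintro ⟨y, hy, rfl⟩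
        exact hx ⟨e.map_target (hKe hy), by rw [e.right_inv (hKe hy)]; exact hKV hy⟩
      have c1 : transplant e F t =ᶠ[nhds x] id := by
        filter_upwards [hc.isOpen_compl.mem_nhds hxc] with y hy
          using transplant_eq_self h.eq_self t hy
      have c2 : mfderiv (𝓡 3) (𝓡 3) (transplant e F t) x v = v :=
        DFunLike.congr_fun ((hasMFDerivAt_id x).congr_of_eventuallyEq c1).mfderiv v
      exact iff_of_eq (congrArg₂ (InPlane ξ) (transplant_eq_self h.eq_self t hxc) c2)

end Transplant

/-! ### Contact structures and families of curves in charts. -/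

section ChartReading

variable {M : Type*} [TopologicalSpace M] [ChartedSpace E3 M]

/-- A contact structure is, near each point and in a chart, the kernel of a contact form. -/
theorem IsContactStructure.exists_isContactForm
    {ξ : ∀ x : M, Submodule ℝ (TangentSpace (𝓡 3) x)} (hξ : IsContactStructure ξ) (x₀ : M) :
    ∃ (A : E3 → E3 →L[ℝ] ℝ) (V : Set E3), IsContactForm A V ∧ V ⊆ (chartAt E3 x₀).target ∧
      chartAt E3 x₀ x₀ ∈ V ∧ ∀ x ∈ (chartAt E3 x₀).source, chartAt E3 x₀ x ∈ V → ∀ v : E3,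
        InPlane ξ x v ↔ A (chartAt E3 x₀ x) (mfderiv (𝓡 3) (𝓡 3) (chartAt E3 x₀) x v) = 0 := by
  obtain ⟨V, α, hV, hx₀, hα, hw, hker⟩ := hξ x₀
  set J : (E3 →L[ℝ] ℝ) ≃ₗᵢ[ℝ] (E3 [⋀^Fin 1]→L[ℝ] ℝ) :=
    ContinuousAlternatingMap.ofSubsingletonLIE (𝕜 := ℝ) (E := E3) (F := ℝ) (0 : Fin 1) with hJ
  set A : E3 → E3 →L[ℝ] ℝ := fun p => J.symm (α p) with hA
  have hAα : ∀ p (v : Fin 1 → E3), α p v = A p (v 0) := by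
    intro p v
    have h1 : J (A p) = α p := J.apply_symm_apply _
    rw [← h1]
    rfl
  have hAs : ContDiffOn ℝ ∞ A V := J.symm.contDiff.comp_contDiffOn hα
  refine ⟨A, V ∩ (chartAt E3 x₀).target, ⟨hV.inter (chartAt E3 x₀).open_target,
    hAs.mono inter_subset_left, fun p hp => ?_⟩, inter_subset_right,
    ⟨hx₀, mem_chart_target E3 x₀⟩, fun x hx hxV v => ?_⟩
  · obtain ⟨u, v, w, h⟩ := hw p hp.1
    refine ⟨u, v, w, ?_⟩
    have hd : DifferentiableAt ℝ α p :=
      (hα.contDiffAt (hV.mem_nhds hp.1)).differentiableAt (by simp)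
    have hAd : DifferentiableAt ℝ A p :=
      (hAs.contDiffAt (hV.mem_nhds hp.1)).differentiableAt (by simp)
    have hf : ∀ (y z : E3), fderiv ℝ (fun q => A q y) p z = fderiv ℝ A p z y := fun y z => by
      rw [fderiv_clm_apply hAd (differentiableAt_const y)]
      simp
    -- For 1-forms the alternating sum defining `extDeriv` has two terms, which are those of `extd`.
    have hext : ∀ y z : E3, extDeriv α p ![y, z] = extd A p y z := by
      intro y z
      rw [extDeriv_apply hd, extd_apply]
      simp [Fin.sum_univ_two, hAα, Fin.removeNth, hf, sub_eq_add_neg]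
    have e : wedgeExtDeriv α p u v w = wedge (A p) (extd A p) u v w := by
      rw [wedgeExtDeriv, wedge, hext, hext, hext, hAα, hAα, hAα]
      rfl
    rwa [← e]
  · exact (hker x hx hxV.1 v).trans (iff_of_eq (congrArg (· = 0) (hAα _ _)))

theorem hasDerivAt_of_hasMFDerivAt {E : Type*} [NormedAddCommGroup E] [NormedSpace ℝ E] {f : ℝ → E}
    {L : ℝ →L[ℝ] E} {s : ℝ} (h : HasMFDerivAt 𝓘(ℝ, ℝ) 𝓘(ℝ, E) f s L) : HasDerivAt f (L 1) s := by
  have h1 : HasFDerivAt f L s := h.hasFDerivAt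
  exact h1.hasDerivAt

/-- The velocity of the exponential parametrization of the circle. -/
noncomputable def circleVelocity (s : ℝ) : EuclideanSpace ℝ (Fin 1) :=
  mfderiv 𝓘(ℝ, ℝ) (𝓡 1) Circle.exp s (1 : ℝ)

attribute [local instance] finrank_real_complex_fact'

/-- After the inclusion of the circle into `ℂ` the velocity becomes `i exp(i s)`, which is not zero.
-/
theorem circleVelocity_ne_zero (s : ℝ) : circleVelocity s ≠ 0 := by
  intro h0
  have h1 : HasMFDerivAt 𝓘(ℝ, ℝ) (𝓡 1) Circle.exp s (mfderiv 𝓘(ℝ, ℝ) (𝓡 1) Circle.exp s) :=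
    ((contMDiff_circleExp (m := ∞)).mdifferentiableAt (by simp)).hasMFDerivAt
  have h2 : HasMFDerivAt (𝓡 1) 𝓘(ℝ, ℂ) (fun z : Circle => (z : ℂ)) (Circle.exp s)
      (mfderiv (𝓡 1) 𝓘(ℝ, ℂ) (fun z : Circle => (z : ℂ)) (Circle.exp s)) :=
    ((contMDiff_coe_sphere (E := ℂ) (n := 1) (m := ∞)).mdifferentiableAt (by simp)).hasMFDerivAt
  have h3 := hasDerivAt_of_hasMFDerivAt (h2.comp s h1)
  have h4 : HasDerivAt (fun s : ℝ => Complex.exp (s * Complex.I))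
      (Complex.exp (s * Complex.I) * (1 * Complex.I)) s :=
    ((Complex.ofRealCLM.hasDerivAt (x := s)).mul_const Complex.I).cexp
  have h5 := h3.unique h4
  have h6 : Complex.exp (s * Complex.I) * (1 * Complex.I) ≠ 0 := by simp [Complex.exp_ne_zero]
  refine h6 (h5.symm.trans ?_)
  exact (congrArg (mfderiv (𝓡 1) 𝓘(ℝ, ℂ) (fun z : Circle => (z : ℂ)) (Circle.exp s)) h0).trans
    (map_zero _)

theorem hasDerivAt_chart_comp_circleExp {e : OpenPartialHomeomorph M E3}
    (he : e ∈ IsManifold.maximalAtlas (𝓡 3) ∞ M) {g : Circle → M} {s : ℝ}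
    (hg : MDifferentiableAt (𝓡 1) (𝓡 3) g (Circle.exp s)) (hs : g (Circle.exp s) ∈ e.source) :
    HasDerivAt (fun s : ℝ => e (g (Circle.exp s)))
      (mfderiv (𝓡 3) (𝓡 3) e (g (Circle.exp s))
        (mfderiv (𝓡 1) (𝓡 3) g (Circle.exp s) (circleVelocity s)) : E3) s := by
  have h1 : HasMFDerivAt 𝓘(ℝ, ℝ) (𝓡 1) Circle.exp s (mfderiv 𝓘(ℝ, ℝ) (𝓡 1) Circle.exp s) :=
    ((contMDiff_circleExp (m := ∞)).mdifferentiableAt (by simp)).hasMFDerivAt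
  have h2 : HasMFDerivAt 𝓘(ℝ, ℝ) (𝓡 3) (fun s : ℝ => g (Circle.exp s)) s _ :=
    HasMFDerivAt.comp (g := g) s hg.hasMFDerivAt h1
  have h3 : HasMFDerivAt (𝓡 3) (𝓡 3) e (g (Circle.exp s)) _ :=
    ((contMDiffAt_of_mem_maximalAtlas he hs).mdifferentiableAt (by simp)).hasMFDerivAt
  have h4 : HasMFDerivAt 𝓘(ℝ, ℝ) (𝓡 3) (fun s : ℝ => e (g (Circle.exp s))) s _ :=
    HasMFDerivAt.comp (g := e) (f := fun s : ℝ => g (Circle.exp s)) s h3 h2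
  exact hasDerivAt_of_hasMFDerivAt h4

/-- `G` is a smooth family of curves, all of them tangent to `ξ` (if `b`) or transverse to `ξ`
(if not `b`). -/
structure IsContactFamily (ξ : ∀ x : M, Submodule ℝ (TangentSpace (𝓡 3) x)) (b : Prop) (ε : ℝ)
    (G : ℝ → Circle → M) : Prop where
  smooth : ContMDiffOn (𝓘(ℝ, ℝ).prod (𝓡 1)) (𝓡 3) ∞ (fun q : ℝ × Circle => G q.1 q.2)
    (Ioo (-ε) ε ×ˢ (univ : Set Circle))
  plane : ∀ t ∈ Ioo (-ε) ε, ∀ θ, ∀ v : EuclideanSpace ℝ (Fin 1), v ≠ 0 →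
    (InPlane ξ (G t θ) (mfderiv (𝓡 1) (𝓡 3) (G t) θ v) ↔ b)

namespace IsContactFamily

variable {ξ : ∀ x : M, Submodule ℝ (TangentSpace (𝓡 3) x)} {b : Prop} {ε : ℝ} {G : ℝ → Circle → M}

theorem contMDiffAt (h : IsContactFamily ξ b ε G) {t : ℝ} (ht : t ∈ Ioo (-ε) ε) (θ : Circle) :
    ContMDiffAt (𝓘(ℝ, ℝ).prod (𝓡 1)) (𝓡 3) ∞ (fun q : ℝ × Circle => G q.1 q.2) (t, θ) :=
  h.smooth.contMDiffAt ((isOpen_Ioo.prod isOpen_univ).mem_nhds ⟨ht, mem_univ _⟩)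

theorem contMDiff_slice (h : IsContactFamily ξ b ε G) {t : ℝ} (ht : t ∈ Ioo (-ε) ε) :
    ContMDiff (𝓡 1) (𝓡 3) ∞ (G t) := fun θ =>
  (h.contMDiffAt ht θ).comp θ (contMDiff_const.prodMk contMDiff_id :
    ContMDiff (𝓡 1) (𝓘(ℝ, ℝ).prod (𝓡 1)) ∞ fun θ : Circle => (t, θ)).contMDiffAt

theorem comp_isContactIsotopyPair (h : IsContactFamily ξ b ε G) {Φ Ψ : ℝ → M → M}
    (hΦ : IsContactIsotopyPair ξ Φ Ψ) : IsContactFamily ξ b ε fun t θ => Φ t (G t θ) where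
  smooth := hΦ.smooth.comp_contMDiffOn (contMDiffOn_fst.prodMk h.smooth)
  plane t ht θ v hv := by
    have e : mfderiv (𝓡 1) (𝓡 3) (fun θ => Φ t (G t θ)) θ v =
        mfderiv (𝓡 3) (𝓡 3) (Φ t) (G t θ) (mfderiv (𝓡 1) (𝓡 3) (G t) θ v) :=
      DFunLike.congr_fun (mfderiv_comp θ (hΦ.mdifferentiableAt t (G t θ))
        ((h.contMDiff_slice ht).mdifferentiableAt (by simp))) v
    exact (iff_of_eq (congrArg (InPlane ξ (Φ t (G t θ))) e)).trans
      ((hΦ.contact t _ _).trans (h.plane t ht θ v hv))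

theorem mono (h : IsContactFamily ξ b ε G) {δ : ℝ} (hδ : δ ≤ ε) : IsContactFamily ξ b δ G where
  smooth := h.smooth.mono (prod_mono (Ioo_subset_Ioo (neg_le_neg hδ) hδ) subset_rfl)
  plane t ht := h.plane t (Ioo_subset_Ioo (neg_le_neg hδ) hδ ht)

variable {e : OpenPartialHomeomorph M E3}

theorem contDiffAt_chart (h : IsContactFamily ξ b ε G)
    (he : e ∈ IsManifold.maximalAtlas (𝓡 3) ∞ M) {x : ℝ × ℝ} (hx : x.1 ∈ Ioo (-ε) ε)
    (hxe : G x.1 (Circle.exp x.2) ∈ e.source) :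
    ContDiffAt ℝ ∞ (fun x : ℝ × ℝ => e (G x.1 (Circle.exp x.2))) x := by
  have h1 : ContMDiffAt 𝓘(ℝ, ℝ × ℝ) (𝓘(ℝ, ℝ).prod (𝓡 1)) ∞
      (fun x : ℝ × ℝ => (x.1, Circle.exp x.2)) x :=
    contDiff_fst.contMDiff.contMDiffAt.prodMk
      (contMDiff_circleExp.comp contDiff_snd.contMDiff).contMDiffAt
  have h2 : ContMDiffAt 𝓘(ℝ, ℝ × ℝ) (𝓡 3) ∞ (fun x : ℝ × ℝ => G x.1 (Circle.exp x.2)) x :=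
    ContMDiffAt.comp (g := fun q : ℝ × Circle => G q.1 q.2) x (h.contMDiffAt hx _) h1
  have h3 : ContMDiffAt 𝓘(ℝ, ℝ × ℝ) (𝓡 3) ∞ (fun x : ℝ × ℝ => e (G x.1 (Circle.exp x.2))) x :=
    ContMDiffAt.comp (g := e) x (contMDiffAt_of_mem_maximalAtlas he hxe) h2
  exact h3.contDiffAt

theorem fderiv_chart (h : IsContactFamily ξ b ε G)
    (he : e ∈ IsManifold.maximalAtlas (𝓡 3) ∞ M) {x : ℝ × ℝ} (hx : x.1 ∈ Ioo (-ε) ε)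
    (hxe : G x.1 (Circle.exp x.2) ∈ e.source) :
    fderiv ℝ (fun x : ℝ × ℝ => e (G x.1 (Circle.exp x.2))) x (0, 1) =
      mfderiv (𝓡 3) (𝓡 3) e (G x.1 (Circle.exp x.2))
        (mfderiv (𝓡 1) (𝓡 3) (G x.1) (Circle.exp x.2) (circleVelocity x.2)) := by
  have h1 := hasDerivAt_chart_comp_circleExp he
    ((h.contMDiff_slice hx).mdifferentiableAt (by simp)) hxe
  have h2 : HasDerivAt (fun s : ℝ => e (G x.1 (Circle.exp s))) _ x.2 :=
    HasFDerivAt.comp_hasDerivAt (l := fun x : ℝ × ℝ => e (G x.1 (Circle.exp x.2)))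
      (f := fun s => (x.1, s)) x.2
      ((h.contDiffAt_chart he hx hxe).differentiableAt (by simp)).hasFDerivAt
      ((hasDerivAt_const x.2 x.1).prodMk (hasDerivAt_id x.2))
  exact h2.unique h1

end IsContactFamily

end ChartReading

/-! ### Following a short arc of the knot. -/

section LocalExtension

variable {M : Type*} [TopologicalSpace M] [ChartedSpace E3 M]

theorem mdifferentiable_of_mem_maximalAtlas {H E N : Type*} [TopologicalSpace H]
    [NormedAddCommGroup E] [NormedSpace ℝ E] {I : ModelWithCorners ℝ E H} [TopologicalSpace N]
    [ChartedSpace H N] [IsManifold I ∞ N] {e : OpenPartialHomeomorph N H}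
    (he : e ∈ IsManifold.maximalAtlas I ∞ N) : e.MDifferentiable I I :=
  ⟨(contMDiffOn_of_mem_maximalAtlas he).mdifferentiableOn (by simp),
    (contMDiffOn_symm_of_mem_maximalAtlas he).mdifferentiableOn (by simp)⟩

/-- Every smooth family of Legendrian or transverse curves starting at `Γ`, and stationary at the
parameters in `S`, is followed at the parameters in `S ∪ B` by a contact isotopy, for a short
time. -/
def IsExtendableOn (ξ : ∀ x : M, Submodule ℝ (TangentSpace (𝓡 3) x)) (Γ : Circle → M)
    (B : Set Circle) : Prop :=
  ∀ (c : Prop) (ε : ℝ) (G : ℝ → Circle → M) (S : Set Circle), 0 < ε →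
    IsContactFamily ξ c ε G → G 0 = Γ → (∀ t ∈ Ioo (-ε) ε, ∀ θ ∈ S, G t θ = Γ θ) →
    ∃ Φ Ψ, IsContactIsotopyPair ξ Φ Ψ ∧ ∃ δ > 0, δ ≤ ε ∧
      ∀ t ∈ Ioo (-δ) δ, ∀ θ ∈ S ∪ B, Φ t (Γ θ) = G t θ

-- The arc and the ball are chosen from `Γ` alone; only the time bound depends on the family. This
-- allows the same `B` to be used after the family has been modified.
open Filter Topology in
theorem exists_isExtendableOn_nhds [T2Space M] [IsManifold (𝓡 3) ∞ M]
    {ξ : ∀ x : M, Submodule ℝ (TangentSpace (𝓡 3) x)} (hξ : IsContactStructure ξ)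
    {Γ : Circle → M} (hΓ : ContMDiff (𝓡 1) (𝓡 3) ∞ Γ) (hinj : Function.Injective Γ)
    (himm : ∀ θ, Function.Injective (mfderiv (𝓡 1) (𝓡 3) Γ θ)) (θ₀ : Circle) :
    ∃ B ∈ 𝓝 θ₀, IsExtendableOn ξ Γ B := by
  obtain ⟨A, V, hA, hVe, hx₀V, hker⟩ := hξ.exists_isContactForm (Γ θ₀)
  set e := chartAt E3 (Γ θ₀) with he_def
  have he : e ∈ IsManifold.maximalAtlas (𝓡 3) ∞ M := IsManifold.chart_mem_maximalAtlas _
  obtain ⟨s₀, rfl⟩ : ∃ s₀, Circle.exp s₀ = θ₀ := ⟨_, Circle.exp_arg θ₀⟩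
  set γ₀ : ℝ → E3 := fun s => e (Γ (Circle.exp s)) with hγ₀
  have hΓc : Continuous fun s : ℝ => Γ (Circle.exp s) := hΓ.continuous.comp Circle.exp.continuous
  have hs₀e : Γ (Circle.exp s₀) ∈ e.source := mem_chart_source E3 _
  have hγs : ∀ s, Γ (Circle.exp s) ∈ e.source → ContDiffAt ℝ ∞ γ₀ s := by
    intro s hs
    have h1 : ContMDiffAt 𝓘(ℝ, ℝ) (𝓡 3) ∞ γ₀ s :=
      ContMDiffAt.comp (g := e) (f := fun s : ℝ => Γ (Circle.exp s)) s
        (contMDiffAt_of_mem_maximalAtlas he hs) (hΓ.comp contMDiff_circleExp).contMDiffAt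
    exact h1.contDiffAt
  set w : E3 := deriv γ₀ s₀ with hw
  have hw0 : w ≠ 0 := by
    have h1 := hasDerivAt_chart_comp_circleExp he (hΓ.mdifferentiableAt (by simp)) hs₀e
    intro h0
    have h2 := h1.deriv.symm.trans h0
    have h3 : Function.Injective (mfderiv (𝓡 3) (𝓡 3) e (Γ (Circle.exp s₀))) :=
      (mdifferentiable_of_mem_maximalAtlas he).mfderiv_injective hs₀e
    have h4 := h3 (h2.trans (map_zero (mfderiv (𝓡 3) (𝓡 3) e (Γ (Circle.exp s₀)))).symm)
    exact circleVelocity_ne_zero s₀ (himm _ (h4.trans (map_zero _).symm))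
  -- The component along the initial velocity increases along the arc near `s₀`, and for nearby
  -- times too.
  set ℓ : E3 →L[ℝ] ℝ := innerSL ℝ w with hℓ
  have hℓw : 0 < ℓ w := by
    rw [hℓ, innerSL_apply_apply]
    exact real_inner_self_pos.2 hw0
  have hγc : ContinuousAt γ₀ s₀ := (hγs s₀ hs₀e).continuousAt
  have hgood : ∀ᶠ s in 𝓝 s₀, Γ (Circle.exp s) ∈ e.source ∧ γ₀ s ∈ V ∧ 0 < ℓ (deriv γ₀ s) := by
    have h1 : ContinuousAt (deriv γ₀) s₀ :=
      ((hγs s₀ hs₀e).continuousAt_fderiv (by simp)).clm_apply continuousAt_const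
    filter_upwards [hΓc.continuousAt.eventually (e.open_source.mem_nhds hs₀e),
      hγc.eventually (hA.isOpen.mem_nhds hx₀V),
      (ℓ.continuous.continuousAt.comp h1).eventually (lt_mem_nhds hℓw)] with s a b c
      using ⟨a, b, c⟩
  obtain ⟨η, hη, hηg⟩ := Metric.eventually_nhds_iff_ball.1 hgood
  set a := s₀ - η / 2 with ha
  set b := s₀ + η / 2 with hb
  have hs₀ab : s₀ ∈ Ioo a b := ⟨by linarith, by linarith⟩
  have hab : ∀ s ∈ Icc a b, Γ (Circle.exp s) ∈ e.source ∧ γ₀ s ∈ V ∧ 0 < ℓ (deriv γ₀ s) := by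
    intro s hs
    refine hηg s ?_
    rw [Metric.mem_ball, Real.dist_eq, abs_lt]
    constructor <;> linarith [hs.1, hs.2]
  set Z : Set Circle := (Circle.exp '' Ioo a b)ᶜ with hZ
  have hZc : IsClosed (Γ '' Z) :=
    ((isLocalHomeomorph_circleExp.isOpenMap _ isOpen_Ioo).isClosed_compl.isCompact.image
      hΓ.continuous).isClosed
  have hZ₀ : Γ (Circle.exp s₀) ∉ Γ '' Z := by
    rintro ⟨θ, hθ, h⟩
    exact hθ (hinj h ▸ mem_image_of_mem _ hs₀ab)
  have hsymm : ∀ᶠ p in 𝓝 (γ₀ s₀), e.symm p ∉ Γ '' Z := by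
    refine (e.continuousAt_symm (e.map_source hs₀e)).eventually (hZc.isOpen_compl.mem_nhds ?_)
    rwa [e.left_inv hs₀e]
  have hcov : ∀ᶠ p in 𝓝 (γ₀ s₀), ∃ s ∈ Ioo a b, ℓ (γ₀ s) = ℓ p := by
    have h1 : HasStrictDerivAt (fun s => ℓ (γ₀ s)) (ℓ w) s₀ :=
      ℓ.hasStrictFDerivAt.comp_hasStrictDerivAt s₀ ((hγs s₀ hs₀e).hasStrictDerivAt (by simp))
    have h2 := h1.map_nhds_eq hℓw.ne'
    have h3 : (fun s => ℓ (γ₀ s)) '' Ioo a b ∈ 𝓝 (ℓ (γ₀ s₀)) :=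
      h2 ▸ image_mem_map (isOpen_Ioo.mem_nhds hs₀ab)
    exact ℓ.continuous.continuousAt.eventually h3
  have hVn : ∀ᶠ p in 𝓝 (γ₀ s₀), p ∈ V := hA.isOpen.mem_nhds hx₀V
  have habn : ∀ᶠ s in 𝓝 s₀, s ∈ Ioo a b := isOpen_Ioo.mem_nhds hs₀ab
  -- The ball lies in `V`, misses the knot outside the arc, and meets only levels of `ℓ` attained on
  -- the arc. Missing the rest of the knot uses injectivity of `Γ`.
  obtain ⟨r, hr, hrg⟩ := Metric.nhds_basis_closedBall.mem_iff.1 (hVn.and (hsymm.and hcov))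
  obtain ⟨η', hη', hηg'⟩ := Metric.nhds_basis_closedBall.mem_iff.1
    (habn.and (hγc.eventually (Metric.ball_mem_nhds _ (half_pos hr))))
  refine ⟨Circle.exp '' Metric.closedBall s₀ η', isLocalHomeomorph_circleExp.isOpenMap.image_mem_nhds
    (Metric.closedBall_mem_nhds _ hη'), fun c ε G S hε hG hG0 hS => ?_⟩
  have h0ε : (0 : ℝ) ∈ Ioo (-ε) ε := ⟨neg_lt_zero.2 hε, hε⟩
  set γ : ℝ × ℝ → E3 := fun x => e (G x.1 (Circle.exp x.2)) with hγ
  have hγ0 : ∀ s, γ (0, s) = γ₀ s := fun s => by simp only [hγ, hγ₀, hG0]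
  have hG0e : ∀ s ∈ Icc a b, G 0 (Circle.exp s) ∈ e.source := fun s hs => by
    rw [hG0]; exact (hab s hs).1
  have hγa : ∀ s ∈ Icc a b, ContDiffAt ℝ ∞ γ (0, s) := fun s hs =>
    hG.contDiffAt_chart he (x := (0, s)) h0ε (hG0e s hs)
  -- Compactness of the closed parameter interval makes the time bound uniform in `s`.
  have hev1 : ∀ᶠ t in 𝓝 (0 : ℝ), ∀ s ∈ Icc a b, G t (Circle.exp s) ∈ e.source ∧ γ (t, s) ∈ V ∧
      0 < ℓ (fderiv ℝ γ (t, s) (0, 1)) := by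
    refine isCompact_Icc.eventually_forall_of_forall_eventually fun s hs => ?_
    have h1 : ContinuousAt (fun x : ℝ × ℝ => G x.1 (Circle.exp x.2)) (0, s) :=
      ContinuousAt.comp (g := fun q : ℝ × Circle => G q.1 q.2)
        (f := fun x : ℝ × ℝ => (x.1, Circle.exp x.2)) (hG.contMDiffAt h0ε _).continuousAt
        (continuous_fst.prodMk (Circle.exp.continuous.comp continuous_snd)).continuousAt
    have h2 : ContinuousAt (fun x => ℓ (fderiv ℝ γ x (0, 1))) (0, s) :=
      ℓ.continuous.continuousAt.comp
        (((hγa s hs).continuousAt_fderiv (by simp)).clm_apply continuousAt_const)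
    have h3 : 0 < ℓ (fderiv ℝ γ (0, s) (0, 1)) := by
      have h4 : HasDerivAt (fun s => γ (0, s)) (fderiv ℝ γ (0, s) (0, 1)) s :=
        ((hγa s hs).differentiableAt (by simp)).hasFDerivAt.comp_hasDerivAt s
          ((hasDerivAt_const s (0 : ℝ)).prodMk (hasDerivAt_id s))
      rw [show (fun s => γ (0, s)) = γ₀ from funext hγ0] at h4
      rw [← h4.deriv]
      exact (hab s hs).2.2
    filter_upwards [h1.eventually (e.open_source.mem_nhds (hG0e s hs)),
      (hγa s hs).continuousAt.eventually
        (hA.isOpen.mem_nhds (show γ (0, s) ∈ V by rw [hγ0]; exact (hab s hs).2.1)),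
      h2.eventually (lt_mem_nhds h3)] with x h1 h2 h3 using ⟨h1, h2, h3⟩
  have hev2 : ∀ᶠ t in 𝓝 (0 : ℝ), ∀ s ∈ Metric.closedBall s₀ η',
      γ (t, s) ∈ Metric.ball (γ₀ s₀) (r / 2) := by
    refine (isCompact_closedBall s₀ η').eventually_forall_of_forall_eventually fun s hs => ?_
    have hs' := hηg' hs
    refine (hγa s (Ioo_subset_Icc_self hs'.1)).continuousAt.eventually
      (Metric.isOpen_ball.mem_nhds ?_)
    rw [hγ0]
    exact hs'.2
  obtain ⟨ε', hε', hεg⟩ := Metric.eventually_nhds_iff_ball.1 (hev1.and hev2)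
  have hball : ∀ ρ : ℝ, Metric.ball (0 : ℝ) ρ = Ioo (-ρ) ρ := fun ρ => by
    rw [Real.ball_eq_Ioo, zero_sub, zero_add]
  rw [hball] at hεg
  set ε₁ := min ε ε' with hε₁
  have hε₁0 : 0 < ε₁ := lt_min hε hε'
  have hsub : Ioo (-ε₁) ε₁ ⊆ Ioo (-ε) ε :=
    Ioo_subset_Ioo (neg_le_neg (min_le_left _ _)) (min_le_left _ _)
  have hsub' : Ioo (-ε₁) ε₁ ⊆ Ioo (-ε') ε' :=
    Ioo_subset_Ioo (neg_le_neg (min_le_right _ _)) (min_le_right _ _)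
  have hpt : ∀ x ∈ Ioo (-ε₁) ε₁ ×ˢ Ioo a b, G x.1 (Circle.exp x.2) ∈ e.source ∧ γ x ∈ V ∧
      0 < ℓ (fderiv ℝ γ x (0, 1)) := fun x hx =>
    (hεg x.1 (hsub' hx.1)).1 x.2 (Ioo_subset_Icc_self hx.2)
  have hplane : ∀ x ∈ Ioo (-ε₁) ε₁ ×ˢ Ioo a b, A (γ x) (fderiv ℝ γ x (0, 1)) = 0 ↔ c := by
    intro x hx
    have h1 := hG.fderiv_chart he (hsub hx.1) (hpt x hx).1
    have h2 := hker _ (hpt x hx).1 (hpt x hx).2.1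
      (mfderiv (𝓡 1) (𝓡 3) (G x.1) (Circle.exp x.2) (circleVelocity x.2))
    have h3 := hG.plane x.1 (hsub hx.1) (Circle.exp x.2) _ (circleVelocity_ne_zero x.2)
    exact (iff_of_eq (congrArg (fun v => A (γ x) v = 0) h1)).trans (h2.symm.trans h3)
  have hcurve : IsCurveFamily A V γ ε₁ a b ℓ := {
    contactForm := hA
    pos := hε₁0
    contDiffOn := fun x hx =>
      (hG.contDiffAt_chart he (hsub hx.1) (hpt x hx).1).contDiffWithinAt
    mem := fun x hx => (hpt x hx).2.1
    increasing := fun x hx => (hpt x hx).2.2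
    contact := by
      by_cases hc : c
      · exact Or.inl fun x hx => (hplane x hx).2 hc
      · exact Or.inr fun x hx => (hplane x hx).not.2 hc }
  obtain ⟨F, F', hF, δ, hδ, hδε, hFγ⟩ := hcurve.exists_isLocalContactIsotopy hr
    (fun p hp => by simpa only [hγ0] using (hrg hp).2.2) (fun p hp => (hrg hp).1)
  refine ⟨transplant e F, transplant e F', hF.isContactIsotopyPair he (isCompact_closedBall _ _)
    (fun p hp => (hrg hp).1) hVe hker, δ, hδ, hδε.trans (min_le_left _ _), ?_⟩
  have hsubδ : Ioo (-δ) δ ⊆ Ioo (-ε₁) ε₁ := Ioo_subset_Ioo (neg_le_neg hδε) hδε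
  have key : ∀ s ∈ Ioo a b, (∀ t ∈ Ioo (-δ) δ, γ (t, s) ∈ Metric.ball (γ₀ s₀) (r / 2)) ∨
      (∀ t ∈ Ioo (-δ) δ, γ (t, s) = γ (0, s)) → ∀ t ∈ Ioo (-δ) δ,
      transplant e F t (Γ (Circle.exp s)) = G t (Circle.exp s) := by
    intro s hs h t ht
    have h1 : F (t, γ₀ s) = γ (t, s) := by
      rw [← hγ0]
      exact hFγ δ hδ le_rfl s hs h t ht
    rw [transplant_of_mem F t (hab s (Ioo_subset_Icc_self hs)).1]
    exact (congrArg e.symm h1).trans (e.left_inv (hpt (t, s) ⟨hsubδ ht, hs⟩).1)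
  rintro t ht θ (hθ | ⟨s, hs, rfl⟩)
  -- A stationary point on the arc is fixed because the contact field vanishes there; one off the
  -- arc lies outside the support of the isotopy.
  · by_cases hθ' : θ ∈ Circle.exp '' Ioo a b
    · obtain ⟨s, hs, rfl⟩ := hθ'
      refine key s hs (Or.inr fun t ht => ?_) t ht
      simp only [hγ]
      rw [hS t (hsub (hsubδ ht)) _ hθ, hG0]
    · rw [hS t (hsub (hsubδ ht)) _ hθ]
      refine transplant_eq_self hF.eq_self t ?_
      rintro ⟨p, hp, hpθ⟩
      exact (hrg hp).2.1 ⟨θ, hθ', hpθ.symm⟩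
  · exact key s (hηg' hs).1 (Or.inl fun t ht => (hεg t (hsub' (hsubδ ht))).2 s hs) t ht

end LocalExtension

/-! ### Following the whole knot for all times. -/

section Extension

variable {M : Type*} [TopologicalSpace M] [ChartedSpace E3 M]
  {ξ : ∀ x : M, Submodule ℝ (TangentSpace (𝓡 3) x)} {Γ : Circle → M}

theorem isExtendableOn_empty : IsExtendableOn ξ Γ ∅ := by
  intro c ε G S hε hG hG0 hS
  refine ⟨_, _, .refl ξ, ε, hε, le_rfl, fun t ht θ hθ => (hS t ht θ ?_).symm⟩
  simpa using hθ

theorem IsExtendableOn.mono {B B' : Set Circle} (h : IsExtendableOn ξ Γ B') (hB : B ⊆ B') :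
    IsExtendableOn ξ Γ B := by
  intro c ε G S hε hG hG0 hS
  obtain ⟨Φ, Ψ, hΦ, δ, hδ, hδε, h⟩ := h c ε G S hε hG hG0 hS
  exact ⟨Φ, Ψ, hΦ, δ, hδ, hδε, fun t ht θ hθ => h t ht θ (union_subset_union_right S hB hθ)⟩

/-- If `Φ` follows `G` on `S ∪ B`, then `Φ⁻¹ G` still starts at `Γ` and is stationary on `S ∪ B`. A
`Φ'` following it on `S ∪ B ∪ B'` gives the composite `Φ Φ'`, which follows `G` there. -/
theorem IsExtendableOn.union {B B' : Set Circle} (h : IsExtendableOn ξ Γ B)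
    (h' : IsExtendableOn ξ Γ B') : IsExtendableOn ξ Γ (B ∪ B') := by
  intro c ε G S hε hG hG0 hS
  obtain ⟨Φ, Ψ, hΦ, δ, hδ, hδε, h⟩ := h c ε G S hε hG hG0 hS
  obtain ⟨Φ', Ψ', hΦ', δ', hδ', hδδ', h'⟩ := h' c δ (fun t θ => Ψ t (G t θ)) (S ∪ B) hδ
    ((hG.mono hδε).comp_isContactIsotopyPair hΦ.symm)
    (by rw [hG0]; exact funext fun θ => hΦ.symm.zero _)
    (fun t ht θ hθ => by rw [← h t ht θ hθ, hΦ.left_inv])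
  refine ⟨_, _, hΦ.comp hΦ', δ', hδ', hδδ'.trans hδε, fun t ht θ hθ => ?_⟩
  rw [← union_assoc] at hθ
  rw [h' t ht θ hθ, hΦ.right_inv]

theorem isExtendableOn_univ [T2Space M] [IsManifold (𝓡 3) ∞ M] (hξ : IsContactStructure ξ)
    (hΓ : ContMDiff (𝓡 1) (𝓡 3) ∞ Γ) (hinj : Function.Injective Γ)
    (himm : ∀ θ, Function.Injective (mfderiv (𝓡 1) (𝓡 3) Γ θ)) : IsExtendableOn ξ Γ univ := by
  refine isCompact_univ.induction_on isExtendableOn_empty (fun _ _ hs h => h.mono hs)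
    (fun _ _ h h' => h.union h') fun θ _ => ?_
  rw [nhdsWithin_univ]
  exact exists_isExtendableOn_nhds hξ hΓ hinj himm θ

/-- The contact isotopy extension theorem, for families parametrized by the whole line. -/
theorem exists_isContactIsotopyPair_of_family [T2Space M] [IsManifold (𝓡 3) ∞ M]
    (hξ : IsContactStructure ξ) {c : Prop} {H : ℝ → Circle → M}
    (hH : ∀ ε, IsContactFamily ξ c ε H) (hinj : ∀ t, Function.Injective (H t))
    (himm : ∀ t θ, Function.Injective (mfderiv (𝓡 1) (𝓡 3) (H t) θ)) (s t : ℝ) :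
    ∃ Φ Ψ, IsContactIsotopyPair ξ Φ Ψ ∧ ∀ θ, Φ 1 (H s θ) = H t θ := by
  -- Being joined by a contact isotopy is a symmetric, transitive relation on times, and it relates
  -- every time to all nearby ones; connectedness of `ℝ` then relates all times. For transitivity
  -- the isotopies are composed time by time, since only their values at time 1 matter.
  refine PreconnectedSpace.induction₂' (fun s t : ℝ => ∃ Φ Ψ, IsContactIsotopyPair ξ Φ Ψ ∧
    ∀ θ, Φ 1 (H s θ) = H t θ) (fun s => ?_) ⟨?_⟩ s t
  · have hs : ∀ τ ε : ℝ, τ ∈ Ioo (-ε) ε → s + τ ∈ Ioo (-(|s| + ε)) (|s| + ε) := by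
      intro τ ε hτ
      constructor <;> linarith [hτ.1, hτ.2, neg_abs_le s, le_abs_self s]
    have hG : IsContactFamily ξ c 1 fun τ => H (s + τ) := by
      refine ⟨?_, fun τ hτ => (hH (|s| + 1)).plane _ (hs τ 1 hτ)⟩
      have h1 : ContMDiff (𝓘(ℝ, ℝ).prod (𝓡 1)) (𝓘(ℝ, ℝ).prod (𝓡 1)) ∞
          fun q : ℝ × Circle => (s + q.1, q.2) :=
        ((contDiff_const.add contDiff_id).contMDiff.comp contMDiff_fst).prodMk contMDiff_snd
      exact (hH (|s| + 1)).smooth.comp h1.contMDiffOn fun q hq => ⟨hs _ _ hq.1, mem_univ _⟩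
    obtain ⟨Φ, Ψ, hΦ, δ, hδ, -, h⟩ := isExtendableOn_univ hξ
      ((hH (|s| + 1)).contMDiff_slice (by simpa using hs 0 1 (by simp))) (hinj s) (himm s) c 1 _ ∅
      one_pos hG (by simp) (by simp)
    filter_upwards [Metric.ball_mem_nhds s hδ] with t ht
    rw [Metric.mem_ball, Real.dist_eq, abs_lt] at ht
    -- Rescaling time by `t - s` moves the map needed, at time `t - s`, to time 1.
    have key : ∀ θ, Φ ((t - s) * 1) (H s θ) = H t θ := fun θ => by
      rw [mul_one, h (t - s) ht θ (by simp), add_sub_cancel]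
    refine ⟨⟨_, _, hΦ.rescale (t - s), key⟩, ⟨_, _, (hΦ.rescale (t - s)).symm, fun θ => ?_⟩⟩
    rw [← key, hΦ.left_inv]
  · rintro s t u ⟨Φ, Ψ, hΦ, h⟩ ⟨Φ', Ψ', hΦ', h'⟩
    exact ⟨_, _, hΦ'.comp hΦ, fun θ => by rw [h, h']⟩

/-- A smooth isotopy through embedded curves, all tangent or all transverse to a contact structure,
is followed by a contact isotopy. -/
theorem IsIsotopyThrough.exists_isContactIsotopy [T2Space M] [IsManifold (𝓡 3) ∞ M]
    (hξ : IsContactStructure ξ) {P : (Circle → M) → Prop} {c : Prop}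
    (hinj : ∀ γ, P γ → Function.Injective γ)
    (himm : ∀ γ, P γ → ∀ θ, Function.Injective (mfderiv (𝓡 1) (𝓡 3) γ θ))
    (hplane : ∀ γ, P γ → ∀ θ (v : EuclideanSpace ℝ (Fin 1)), v ≠ 0 →
      (InPlane ξ (γ θ) (mfderiv (𝓡 1) (𝓡 3) γ θ v) ↔ c))
    {F : ℝ → Circle → M} (hF : IsIsotopyThrough P F) :
    ∃ φ : ℝ → (M ≃ₘ⟮𝓡 3, 𝓡 3⟯ M), IsContactIsotopy ξ φ ∧ ∀ θ, φ 1 (F 0 θ) = F 1 θ := by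
  -- Precomposition with the smooth step extends the family from `[0,1]` to the whole line, keeping
  -- it smooth and keeping its two ends.
  have hI : ∀ t, Real.smoothTransition t ∈ Icc (0 : ℝ) 1 := fun t =>
    ⟨Real.smoothTransition.nonneg t, Real.smoothTransition.le_one t⟩
  have hP : ∀ t, P (F (Real.smoothTransition t)) := fun t => hF.2 _ (hI t)
  have hs : ContMDiff (𝓘(ℝ, ℝ).prod (𝓡 1)) (𝓘(ℝ, ℝ).prod (𝓡 1)) ∞
      fun q : ℝ × Circle => (Real.smoothTransition q.1, q.2) :=
    ((Real.smoothTransition.contDiff (n := ⊤)).contMDiff.comp contMDiff_fst).prodMk contMDiff_snd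
  obtain ⟨Φ, Ψ, hΦ, h⟩ := exists_isContactIsotopyPair_of_family hξ (c := c)
    (H := fun t => F (Real.smoothTransition t))
    (fun ε => ⟨hF.1.comp hs.contMDiffOn fun q _ => ⟨hI _, mem_univ _⟩,
      fun t _ => hplane _ (hP t)⟩)
    (fun t => hinj _ (hP t)) (fun t => himm _ (hP t)) 0 1
  refine ⟨_, hΦ.isContactIsotopy, fun θ => ?_⟩
  have h1 := h θ
  simp only [Real.smoothTransition.zero, Real.smoothTransition.one] at h1
  exact h1

end Extension

/-! ### Immersions and embeddings under diffeomorphisms. -/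

section Immersion

variable {M : Type*} [TopologicalSpace M] [ChartedSpace E3 M] [IsManifold (𝓡 3) ∞ M]

/-- In suitable charts the map is the injective linear inclusion `L`, and the derivatives of charts
are injective. -/
theorem injective_mfderiv_of_isImmersionAt {f : Circle → M} {x : Circle}
    (h : IsImmersionAt (𝓡 1) (𝓡 3) ∞ f x) : Function.Injective (mfderiv (𝓡 1) (𝓡 3) f x) := by
  have hfd : MDifferentiableAt (𝓡 1) (𝓡 3) f x := h.contMDiffAt.mdifferentiableAt (by simp)
  have hd := mdifferentiable_of_mem_maximalAtlas h.domChart_mem_maximalAtlas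
  have hc := mdifferentiable_of_mem_maximalAtlas h.codChart_mem_maximalAtlas
  set L : EuclideanSpace ℝ (Fin 1) →L[ℝ] E3 :=
    (h.equiv : EuclideanSpace ℝ (Fin 1) × h.complement →L[ℝ] E3) ∘L .inl ℝ _ _ with hL
  have c1 : HasMFDerivAt (𝓡 1) (𝓡 3) (fun y => h.codChart (f y)) x _ :=
    HasMFDerivAt.comp x (g := h.codChart)
      (hc.mdifferentiableAt h.mem_codChart_source).hasMFDerivAt hfd.hasMFDerivAt
  have c2 : HasMFDerivAt (𝓡 1) (𝓡 3) (fun y => L (h.domChart y)) x _ :=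
    HasMFDerivAt.comp x (g := L) (f := h.domChart) L.hasMFDerivAt
      (hd.mdifferentiableAt h.mem_domChart_source).hasMFDerivAt
  have c3 : (fun y => h.codChart (f y)) =ᶠ[nhds x] fun y => L (h.domChart y) := by
    filter_upwards [h.domChart.open_source.mem_nhds h.mem_domChart_source] with y hy
    have h1 := h.writtenInCharts (show h.domChart y ∈ (h.domChart.extend (𝓡 1)).target by
      simpa using h.domChart.map_source hy)
    simpa [hL, h.domChart.left_inv hy] using h1
  have c4 := hasMFDerivAt_unique c1 (c2.congr_of_eventuallyEq c3)
  have hLi : Function.Injective L := h.equiv.injective.comp (Prod.mk_left_injective 0)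
  have hinj : Function.Injective (L ∘ mfderiv (𝓡 1) (𝓡 1) h.domChart x) :=
    hLi.comp (hd.mfderiv_injective h.mem_domChart_source)
  intro v w hvw
  refine hinj ?_
  have e1 := DFunLike.congr_fun c4 v
  have e2 := DFunLike.congr_fun c4 w
  exact e1.symm.trans ((congrArg (mfderiv (𝓡 3) (𝓡 3) h.codChart (f x)) hvw).trans e2)

/-- Precomposing the target chart with `φ⁻¹` leaves the local expression of the immersion unchanged.
-/
theorem isSmoothEmbedding_diffeomorph_comp {f : Circle → M}
    (h : IsSmoothEmbedding (𝓡 1) (𝓡 3) ∞ f) (φ : M ≃ₘ⟮𝓡 3, 𝓡 3⟯ M) :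
    IsSmoothEmbedding (𝓡 1) (𝓡 3) ∞ (φ ∘ f) := by
  refine ⟨?_, φ.toHomeomorph.isEmbedding.comp h.isEmbedding⟩
  obtain ⟨F, i1, i2, hF⟩ := h.isImmersion
  refine ⟨F, i1, i2, fun x => ?_⟩
  have hx := hF x
  set e : OpenPartialHomeomorph M E3 :=
    φ.symm.toHomeomorph.toOpenPartialHomeomorph.trans hx.codChart with he
  have hes : e.source = φ.symm ⁻¹' hx.codChart.source := by
    simp [he]
  have het : e.target = hx.codChart.target := by
    simp [he]
  have hea : e ∈ IsManifold.maximalAtlas (𝓡 3) ∞ M := by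
    refine e.mem_maximalAtlas_of_contMDiffOn ?_ ?_
    · exact (contMDiffOn_of_mem_maximalAtlas hx.codChart_mem_maximalAtlas).comp
        φ.symm.contMDiff.contMDiffOn fun y hy => by rwa [hes] at hy
    · rw [het]
      exact φ.contMDiff.comp_contMDiffOn
        (contMDiffOn_symm_of_mem_maximalAtlas hx.codChart_mem_maximalAtlas)
  refine .mk_of_charts hx.equiv hx.domChart e hx.mem_domChart_source ?_
    hx.domChart_mem_maximalAtlas hea (fun y hy => ?_) fun y hy => ?_
  · simpa [hes] using hx.mem_codChart_source
  · simpa [hes] using hx.source_subset_preimage_source hy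
  · have h1 := hx.writtenInCharts hy
    simpa [he] using h1

end Immersion

/-! ### Legendrian and transverse knots under contact isotopies. -/

section Knots

variable {M : Type*} [TopologicalSpace M] [ChartedSpace E3 M]
  {ξ : ∀ x : M, Submodule ℝ (TangentSpace (𝓡 3) x)} {γ : Circle → M}

theorem injective_mfderiv_of_isSmoothEmbedding [IsManifold (𝓡 3) ∞ M]
    (h : IsSmoothEmbedding (𝓡 1) (𝓡 3) ∞ γ)
    (θ : Circle) : Function.Injective (mfderiv (𝓡 1) (𝓡 3) γ θ) :=
  injective_mfderiv_of_isImmersionAt (h.isImmersion.isImmersionAt θ)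

theorem IsLegendrianEmbedding.inPlane (h : IsLegendrianEmbedding ξ γ) (θ : Circle)
    (v : EuclideanSpace ℝ (Fin 1)) : InPlane ξ (γ θ) (mfderiv (𝓡 1) (𝓡 3) γ θ v) :=
  h.2 θ ⟨v, rfl⟩

theorem IsTransverseEmbedding.not_inPlane [IsManifold (𝓡 3) ∞ M]
    (h : IsTransverseEmbedding ξ γ) (θ : Circle) {v : EuclideanSpace ℝ (Fin 1)} (hv : v ≠ 0) :
    ¬InPlane ξ (γ θ) (mfderiv (𝓡 1) (𝓡 3) γ θ v) := fun hn =>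
  hv (injective_mfderiv_of_isSmoothEmbedding h.1 θ
    (((Submodule.disjoint_def.1 (h.2 θ).disjoint) _ ⟨v, rfl⟩ hn).trans (map_zero _).symm))

theorem range_mfderiv_comp (hγ : IsSmoothEmbedding (𝓡 1) (𝓡 3) ∞ γ) (φ : M ≃ₘ⟮𝓡 3, 𝓡 3⟯ M)
    (θ : Circle) : (mfderiv (𝓡 1) (𝓡 3) (φ ∘ γ) θ).range =
      (mfderiv (𝓡 1) (𝓡 3) γ θ).range.map (mfderiv (𝓡 3) (𝓡 3) φ (γ θ)).toLinearMap := by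
  have h1 : mfderiv (𝓡 1) (𝓡 3) (φ ∘ γ) θ =
      (mfderiv (𝓡 3) (𝓡 3) φ (γ θ)).comp (mfderiv (𝓡 1) (𝓡 3) γ θ) :=
    mfderiv_comp θ (φ.contMDiff.mdifferentiableAt (by simp))
      (hγ.contMDiff.mdifferentiableAt (by simp))
  rw [h1]
  exact LinearMap.range_comp _ _

theorem IsLegendrianEmbedding.comp_isContactomorphism [IsManifold (𝓡 3) ∞ M]
    (h : IsLegendrianEmbedding ξ γ) {φ : M ≃ₘ⟮𝓡 3, 𝓡 3⟯ M} (hφ : IsContactomorphism ξ φ) : IsLegendrianEmbedding ξ (φ ∘ γ) := by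
  refine ⟨isSmoothEmbedding_diffeomorph_comp h.1 φ, fun θ => ?_⟩
  rw [range_mfderiv_comp h.1 φ θ]
  exact (Submodule.map_mono (h.2 θ)).trans (hφ (γ θ)).le

theorem IsTransverseEmbedding.comp_isContactomorphism [IsManifold (𝓡 3) ∞ M]
    (h : IsTransverseEmbedding ξ γ) {φ : M ≃ₘ⟮𝓡 3, 𝓡 3⟯ M} (hφ : IsContactomorphism ξ φ) : IsTransverseEmbedding ξ (φ ∘ γ) := by
  refine ⟨isSmoothEmbedding_diffeomorph_comp h.1 φ, fun θ => ?_⟩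
  rw [range_mfderiv_comp h.1 φ θ]
  have h1 := (Submodule.orderIsoMapComap
    (φ.mfderivToContinuousLinearEquiv (by simp) (γ θ)).toLinearEquiv).isCompl_iff.1 (h.2 θ)
  exact (hφ (γ θ)) ▸ h1

/-- A contact isotopy carries a knot along an isotopy. -/
theorem IsContactIsotopy.isIsotopyThrough {P : (Circle → M) → Prop}
    (hP : ∀ γ, P γ → ∀ φ, IsContactomorphism ξ φ → P (φ ∘ γ)) {φ : ℝ → (M ≃ₘ⟮𝓡 3, 𝓡 3⟯ M)}
    (hφ : IsContactIsotopy ξ φ) (hγ : P γ) (hγs : ContMDiff (𝓡 1) (𝓡 3) ∞ γ) :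
    IsIsotopyThrough P fun t => φ t ∘ γ := by
  refine ⟨?_, fun t ht => hP γ hγ _ (hφ.2.1 t ht)⟩
  have h1 : ContMDiff (𝓘(ℝ, ℝ).prod (𝓡 1)) (𝓘(ℝ, ℝ).prod (𝓡 3)) ∞
      fun q : ℝ × Circle => (q.1, γ q.2) :=
    contMDiff_fst.prodMk (hγs.comp contMDiff_snd)
  exact hφ.1.comp h1.contMDiffOn fun q hq => ⟨hq.1, mem_univ _⟩

theorem IsIsotopyThrough.exists_isContactIsotopy_of_legendrian [T2Space M]
    [IsManifold (𝓡 3) ∞ M] (hξ : IsContactStructure ξ) {F : ℝ → Circle → M}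
    (hF : IsIsotopyThrough (IsLegendrianEmbedding ξ) F) :
    ∃ φ : ℝ → (M ≃ₘ⟮𝓡 3, 𝓡 3⟯ M), IsContactIsotopy ξ φ ∧ φ 1 ∘ F 0 = F 1 := by
  obtain ⟨φ, hφ, h⟩ := hF.exists_isContactIsotopy hξ (c := True)
    (fun γ hγ => hγ.1.isEmbedding.injective)
    (fun γ hγ => injective_mfderiv_of_isSmoothEmbedding hγ.1)
    fun γ hγ θ v _ => iff_true_intro (hγ.inPlane θ v)
  exact ⟨φ, hφ, funext h⟩

theorem IsIsotopyThrough.exists_isContactIsotopy_of_transverse [T2Space M]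
    [IsManifold (𝓡 3) ∞ M] (hξ : IsContactStructure ξ) {F : ℝ → Circle → M}
    (hF : IsIsotopyThrough (IsTransverseEmbedding ξ) F) :
    ∃ φ : ℝ → (M ≃ₘ⟮𝓡 3, 𝓡 3⟯ M), IsContactIsotopy ξ φ ∧ φ 1 ∘ F 0 = F 1 := by
  obtain ⟨φ, hφ, h⟩ := hF.exists_isContactIsotopy hξ (c := False)
    (fun γ hγ => hγ.1.isEmbedding.injective)
    (fun γ hγ => injective_mfderiv_of_isSmoothEmbedding hγ.1)
    fun γ hγ θ v hv => iff_false_intro (hγ.not_inPlane θ hv)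
  exact ⟨φ, hφ, funext h⟩

theorem IsContactIsotopy.zero_comp {φ : ℝ → (M ≃ₘ⟮𝓡 3, 𝓡 3⟯ M)} (hφ : IsContactIsotopy ξ φ)
    (γ : Circle → M) : φ 0 ∘ γ = γ :=
  funext fun θ => hφ.2.2 (γ θ)

end Knots

end ContactKnots

theorem mainTheorem2 {M : Type*} [TopologicalSpace M] [T2Space M] [SecondCountableTopology M]
    [ChartedSpace ContactKnots.E3 M] [IsManifold (𝓡 3) ∞ M]
    (ξ : ∀ x : M, Submodule ℝ (TangentSpace (𝓡 3) x))
    (hξ : ContactKnots.IsContactStructure ξ) :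
    (∀ L₀ L₁ : Set M, ContactKnots.IsLegendrianKnot ξ L₀ → ContactKnots.IsLegendrianKnot ξ L₁ →
      (ContactKnots.LegendrianIsotopic ξ L₀ L₁ ↔ ContactKnots.AmbientContactIsotopic ξ L₀ L₁)) ∧
    (∀ T₀ T₁ : Set M, ContactKnots.IsTransverseKnot ξ T₀ → ContactKnots.IsTransverseKnot ξ T₁ →
      (ContactKnots.TransverseIsotopic ξ T₀ T₁ ↔ ContactKnots.AmbientContactIsotopic ξ T₀ T₁)) ∧
    (∀ γ₀ γ₁ : Circle → M,
      ContactKnots.IsLegendrianEmbedding ξ γ₀ → ContactKnots.IsLegendrianEmbedding ξ γ₁ →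
      (ContactKnots.OrientedLegendrianIsotopic ξ γ₀ γ₁ ↔
        ContactKnots.OrientedContactIsotopic ξ γ₀ γ₁)) ∧
    (∀ γ₀ γ₁ : Circle → M,
      ContactKnots.IsTransverseEmbedding ξ γ₀ → ContactKnots.IsTransverseEmbedding ξ γ₁ →
      (ContactKnots.OrientedTransverseIsotopic ξ γ₀ γ₁ ↔
        ContactKnots.OrientedContactIsotopic ξ γ₀ γ₁)) := by
  refine ⟨fun L₀ L₁ h₀ _ => ⟨?_, ?_⟩, fun T₀ T₁ h₀ _ => ⟨?_, ?_⟩, fun γ₀ γ₁ h₀ _ => ⟨?_, ?_⟩,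
    fun γ₀ γ₁ h₀ _ => ⟨?_, ?_⟩⟩
  · rintro ⟨F, hF, rfl, rfl⟩
    obtain ⟨φ, hφ, h⟩ := hF.exists_isContactIsotopy_of_legendrian hξ
    exact ⟨φ, hφ, by rw [← range_comp, h]⟩
  · rintro ⟨φ, hφ, rfl⟩
    obtain ⟨γ, hγ, rfl⟩ := h₀
    exact ⟨_, hφ.isIsotopyThrough (fun _ h _ => h.comp_isContactomorphism) hγ hγ.1.contMDiff,
      congrArg range (hφ.zero_comp γ), range_comp _ _⟩
  · rintro ⟨F, hF, rfl, rfl⟩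
    obtain ⟨φ, hφ, h⟩ := hF.exists_isContactIsotopy_of_transverse hξ
    exact ⟨φ, hφ, by rw [← range_comp, h]⟩
  · rintro ⟨φ, hφ, rfl⟩
    obtain ⟨γ, hγ, rfl⟩ := h₀
    exact ⟨_, hφ.isIsotopyThrough (fun _ h _ => h.comp_isContactomorphism) hγ hγ.1.contMDiff,
      congrArg range (hφ.zero_comp γ), range_comp _ _⟩
  -- The ambient isotopy carries `F 0` to `F 1` as parametrized curves, so orientations are
  -- respected automatically.
  · rintro ⟨F, hF, rfl, h1⟩
    obtain ⟨φ, hφ, h⟩ := hF.exists_isContactIsotopy_of_legendrian hξ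
    exact ⟨φ, hφ, h ▸ h1⟩
  · rintro ⟨φ, hφ, h1⟩
    exact ⟨_, hφ.isIsotopyThrough (fun _ h _ => h.comp_isContactomorphism) h₀ h₀.1.contMDiff,
      hφ.zero_comp γ₀, h1⟩
  · rintro ⟨F, hF, rfl, h1⟩
    obtain ⟨φ, hφ, h⟩ := hF.exists_isContactIsotopy_of_transverse hξ
    exact ⟨φ, hφ, h ▸ h1⟩
  · rintro ⟨φ, hφ, h1⟩
    exact ⟨_, hφ.isIsotopyThrough (fun _ h _ => h.comp_isContactomorphism) h₀ h₀.1.contMDiff,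
      hφ.zero_comp γ₀, h1⟩
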